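/- **Notation.** For $\phi\in L^2(\mathbb R)$ (complex-valued) let $\mathcal F\phi=\hat\phi$ be the Fourier transform, $\hat\phi(\xi)=\frac1{\sqrt{2\pi}}\int_{\mathbb R}e^{-iy\xi}\phi(y)\,dy$ (extended to $L^2$ by Plancherel), and let $U(t)=\exp(i\frac t2\partial_x^2)$, i.e. $\mathcal F[U(t)\phi](\xi)=e^{-it\xi^2/2}\hat\phi(\xi)$. With $\langle x\rangle=\sqrt{1+x^2}$, put $\|\phi\|_{H^1}=\|\langle\cdot\rangle\hat\phi\|_{L^2}$ and $\|\phi\|_{H^{1,1}}=\|\langle\cdot\rangle\phi\|_{H^1}$ (equal to $+\infty$ if $\langle\cdot\rangle\phi\notin H^1$). Consider the system $$i\partial_tu_1+\tfrac12\partial_x^2u_1=-i|u_2|^2u_1,\qquad i\partial_tu_2+\tfrac12\partial_x^2u_2=-i|u_1|^2u_2,\qquad x\in\mathbb R. \tag{1}$$ A solution of (1) for $t\ge T_0$ is a pair $u=(u_1,u_2)$ with $u_j\in C([T_0,\infty);L^2(\mathbb R))$ which satisfies (1) for every $t>T_0$ in the sense of tempered distributions in $x$: for every Schwartz function $\varphi$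 and $t>T_0$, and $(j,k)=(1,2),(2,1)$, the function $|u_k(t)|^2u_j(t)\varphi$ is integrable and $$\frac{d}{dt}\int u_j(t)\varphi\,dx=\frac i2\int u_j(t)\varphi''\,dx-\int|u_k(t)|^2u_j(t)\varphi\,dx .$$ **Proposition B.1.** Let $T_0\ge1$, and let $u=(u_1,u_2)$ be a solution of (1) for $t\ge T_0$ such that, for some $\gamma\in(0,1/12)$ and for $j=1,2$, $$\sup_{t\ge T_0}\Bigl(t^{-\gamma}\|U(-t)u_j(t)\|_{H^{1,1}}+\|\mathcal F\,U(-t)u_j(t)\|_{L^\infty}\Bigr)<\infty .$$ If there is $\psi^+=(\psi_1^+,\psi_2^+)\in L^2$ with $\hat\psi_1^+,\hat\psi_2^+\in L^\infty$ such that $$\lim_{t\to+\infty}\|u_j(t)-U(t)\psi_j^+\|_{L^2}=0,\qquad j=1,2,$$ then $\hat\psi_1^+(\xi)\,\hat\psi_2^+(\xi)=0$ for almost every $\xi\in\mathbb R$. -/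

import Mathlib

open MeasureTheory Filter Topology
open scoped ENNReal FourierTransform SchwartzMap

noncomputable section

/-- The Hilbert space `L²(ℝ)` of complex-valued functions. -/
abbrev L2R : Type := Lp ℂ 2 (volume : Measure ℝ)

/-- The Fourier transform with the normalization
`(2π)^{-1/2} ∫ e^{-iyξ} φ(y) dy`, extended to `L²(ℝ)` by Plancherel. Mathlib's transform uses the
kernel `e^{-2πiyξ}`, hence the change of scale. The result is a function defined up to
a null set. -/
def hat (φ : L2R) (ξ : ℝ) : ℂ :=
  ((√(2 * Real.pi))⁻¹ : ℝ) * (𝓕 φ : L2R) (ξ / (2 * Real.pi))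

/-- The free Schroedinger symbol `e^{-itη²/2}` at the frequency `η = 2πξ`. -/
def freeSymbol (t ξ : ℝ) : ℂ :=
  Complex.exp (((-(t * (2 * Real.pi * ξ) ^ 2 / 2) : ℝ) : ℂ) * Complex.I)

theorem memLp_freeSymbol_mul (t : ℝ) (f : L2R) :
    MemLp (fun ξ => freeSymbol t ξ * f ξ) 2 volume := by
  refine (Lp.memLp f).of_le ?_ (Eventually.of_forall fun ξ => ?_)
  · refine AEStronglyMeasurable.mul ?_ (Lp.aestronglyMeasurable f)
    refine Continuous.aestronglyMeasurable ?_
    unfold freeSymbol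
    fun_prop
  · simp only [freeSymbol, norm_mul, Complex.norm_exp_ofReal_mul_I, one_mul, le_refl]

/-- The free Schroedinger group `U(t) = exp(i (t/2) ∂ₓ²)` on `L²(ℝ)`, as a Fourier multiplier. -/
def freeU (t : ℝ) (φ : L2R) : L2R :=
  𝓕⁻ ((memLp_freeSymbol_mul t (𝓕 φ)).toLp)

/-- The Japanese bracket `⟨x⟩ = √(1 + x²)`. -/
def jb (x : ℝ) : ℝ := √(1 + x ^ 2)

/-- The norm of `H^s(ℝ)`: the `L²` norm of `⟨ξ⟩^s φ̂(ξ)` (it is `∞` outside `H^s`). -/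
def sobolevNorm (s : ℝ) (φ : L2R) : ℝ≥0∞ :=
  eLpNorm (fun ξ => ((jb ξ ^ s : ℝ) : ℂ) * hat φ ξ) 2 volume

open Classical in
/-- The norm `‖⟨x⟩^{s'} φ‖_{H^s}` of the weighted Sobolev space `H^{s,s'}(ℝ)`
(it is `∞` outside `H^{s,s'}`). -/
def weightedSobolevNorm (s s' : ℝ) (φ : L2R) : ℝ≥0∞ :=
  if h : MemLp (fun x => ((jb x ^ s' : ℝ) : ℂ) * φ x) 2 volume then sobolevNorm s h.toLp else ∞

/-- The nonlinearity `|v|² u`. -/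
def cubic (v u : L2R) (x : ℝ) : ℂ := ((‖v x‖ ^ 2 : ℝ) : ℂ) * u x

/-- The curve `u` in `L²(ℝ)` solves `i ∂ₜu + (1/2) ∂ₓ²u = -i |v|² u` for `t > T₀` in the sense of
tempered distributions in `x`. The equation is `∂ₜu = (i/2) ∂ₓ²u - |v|² u`, tested against
an arbitrary Schwartz function `φ`; the integrability clause says that the
nonlinearity pairs with `φ`. -/
def SolvesComponent (T₀ : ℝ) (u v : ℝ → L2R) : Prop :=
  ∀ φ : 𝓢(ℝ, ℂ), ∀ t : ℝ, T₀ < t →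
    Integrable (fun x => cubic (v t) (u t) x * φ x) volume ∧
    HasDerivAt (fun τ : ℝ => ∫ x, u τ x * φ x)
      (Complex.I / 2 * (∫ x, u t x * iteratedDeriv 2 φ x)
        - ∫ x, cubic (v t) (u t) x * φ x) t

/-- `(u₁, u₂) ∈ C([T₀, ∞); L²)` solves the system
`i ∂ₜu₁ + (1/2) ∂ₓ²u₁ = -i |u₂|² u₁`, `i ∂ₜu₂ + (1/2) ∂ₓ²u₂ = -i |u₁|² u₂` for `t ≥ T₀`. -/
structure IsSolution (T₀ : ℝ) (u₁ u₂ : ℝ → L2R) : Prop where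
  continuousOn_fst : ContinuousOn u₁ (Set.Ici T₀)
  continuousOn_snd : ContinuousOn u₂ (Set.Ici T₀)
  eqn_fst : SolvesComponent T₀ u₁ u₂
  eqn_snd : SolvesComponent T₀ u₂ u₁

/-- `sup_{t ≥ T₀} (t^{-γ} ‖U(-t)u(t)‖_{H^{1,1}} + ‖F U(-t)u(t)‖_{L^∞}) < ∞`. -/
def ProfileBounded (T₀ γ : ℝ) (u : ℝ → L2R) : Prop :=
  (⨆ t ∈ Set.Ici T₀,
    (ENNReal.ofReal (t ^ (-γ)) * weightedSobolevNorm 1 1 (freeU (-t) (u t))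
      + eLpNorm (hat (freeU (-t) (u t))) ∞ volume)) < ∞

/-- `u(t)` is asymptotic in `L²` to the free solution `U(t)ψ` as `t → +∞`. -/
def ScattersTo (u : ℝ → L2R) (ψ : L2R) : Prop :=
  Tendsto (fun t : ℝ => ‖u t - freeU t ψ‖) atTop (𝓝 0)

end

/-! The argument is the classical obstruction to scattering at the critical decay rate `1/t`. The
free group factors as quadratic phase, dilation, Fourier transform, quadratic phase (`freeU_ae_eq`).
Hence `u_j(t)` is `kernelConst t * chirp t` times a rescaled `profile`, the Fourier transform of
`chirp t * U(-t)u_j(t)`. The profiles are bounded uniformly in `t` (`ProfileBounded.exists_bound`),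
and by scattering they converge in `L²` to `𝓕 ψ_j` (`ScattersTo.tendsto_profile`).

Pair `u₁(t)` with a wave `testWave θ t` evolving so that the kinetic terms cancel. The derivative of
the pairing is then minus the integral of `|u₂|² u₁` against that wave
(`SolvesComponent.hasDerivAt_testWave`). In profile variables all phases cancel, leaving exactly
`(2πt)⁻¹` times a trilinear integral (`integral_cubic_testWave`), which converges to `∫ |𝓕 ψ₂|² 𝓕 ψ₁
θ` (`tendsto_integral_cubic_mul`). The pairing itself stays bounded, while a nonzero limit would
make it grow like `log t` (`eq_zero_of_bounded_of_tendsto_mul_deriv`). So the limit vanishes for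
every Schwartz `θ`, whence `|𝓕 ψ₂|² 𝓕 ψ₁ = 0` almost everywhere. -/

/-! ### The free symbol and the free group on `L²`. -/

theorem iteratedDeriv_cexp_ofReal_mul_I (n : ℕ) :
    iteratedDeriv n (fun x : ℝ => Complex.exp (x * Complex.I)) =
      fun x : ℝ => Complex.I ^ n * Complex.exp (x * Complex.I) := by
  induction n with
  | zero => simp
  | succ n ih =>
    rw [iteratedDeriv_succ, ih]
    ext x
    have h : HasDerivAt (fun x : ℝ => Complex.exp (x * Complex.I))
        (Complex.exp (x * Complex.I) * (1 * Complex.I)) x :=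
      ((Complex.ofRealCLM.hasDerivAt (x := x)).mul_const Complex.I).cexp
    rw [(h.const_mul _).deriv, pow_succ]
    ring

theorem hasTemperateGrowth_cexp_ofReal_mul_I :
    (fun x : ℝ => Complex.exp (x * Complex.I)).HasTemperateGrowth := by
  refine ⟨(Complex.ofRealCLM.contDiff.mul contDiff_const).cexp, fun n => ⟨0, 1, fun x => ?_⟩⟩
  rw [norm_iteratedFDeriv_eq_norm_iteratedDeriv, iteratedDeriv_cexp_ofReal_mul_I]
  simp [Complex.norm_exp_ofReal_mul_I]

theorem freeSymbol_hasTemperateGrowth (t : ℝ) : (freeSymbol t).HasTemperateGrowth := by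
  have h : (fun ξ : ℝ => -(t * (2 * Real.pi * ξ) ^ 2 / 2)).HasTemperateGrowth := by
    have : (fun ξ : ℝ => -(t * (2 * Real.pi * ξ) ^ 2 / 2)) =
        fun ξ : ℝ => (-(t * (2 * Real.pi) ^ 2 / 2)) * ξ ^ 2 := by
      ext ξ; ring
    rw [this]
    exact (Function.HasTemperateGrowth.const _).mul (Function.HasTemperateGrowth.id'.pow 2)
  exact hasTemperateGrowth_cexp_ofReal_mul_I.comp h

@[simp]
theorem norm_freeSymbol (t ξ : ℝ) : ‖freeSymbol t ξ‖ = 1 :=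
  Complex.norm_exp_ofReal_mul_I _

theorem freeSymbol_mul_neg (t ξ : ℝ) : freeSymbol t ξ * freeSymbol (-t) ξ = 1 := by
  rw [freeSymbol, freeSymbol, ← Complex.exp_add, ← add_mul, ← Complex.ofReal_add]
  simp [neg_div]

theorem coeFn_fourier_freeU (t : ℝ) (f : L2R) :
    (𝓕 (freeU t f) : L2R) =ᵐ[volume] fun ξ => freeSymbol t ξ * (𝓕 f : L2R) ξ := by
  rw [freeU, FourierTransform.fourier_fourierInv_eq]
  exact MemLp.coeFn_toLp _

theorem fourier_injective_L2 : Function.Injective (fun f : L2R => (𝓕 f : L2R)) :=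
  (Lp.fourierTransformₗᵢ ℝ ℂ).injective

theorem freeU_freeU_neg (t : ℝ) (f : L2R) : freeU t (freeU (-t) f) = f := by
  apply fourier_injective_L2
  apply Lp.ext
  filter_upwards [coeFn_fourier_freeU t (freeU (-t) f), coeFn_fourier_freeU (-t) f] with ξ h₁ h₂
  rw [h₁, h₂, ← mul_assoc, freeSymbol_mul_neg, one_mul]

theorem norm_freeU (t : ℝ) (f : L2R) : ‖freeU t f‖ = ‖f‖ := by
  rw [← Lp.norm_fourier_eq, ← Lp.norm_fourier_eq f, Lp.norm_def, Lp.norm_def]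
  congr 1
  apply eLpNorm_congr_norm_ae
  filter_upwards [coeFn_fourier_freeU t f] with ξ h
  rw [h, norm_mul, norm_freeSymbol, one_mul]

theorem norm_freeU_sub (t : ℝ) (f g : L2R) : ‖freeU t f - freeU t g‖ = ‖f - g‖ := by
  rw [← Lp.norm_fourier_eq, ← Lp.norm_fourier_eq (f - g), sub_eq_add_neg, sub_eq_add_neg,
    FourierTransform.fourier_add, FourierTransform.fourier_add, FourierTransform.fourier_neg,
    FourierTransform.fourier_neg, ← sub_eq_add_neg, ← sub_eq_add_neg, Lp.norm_def, Lp.norm_def]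
  congr 1
  apply eLpNorm_congr_norm_ae
  filter_upwards [coeFn_fourier_freeU t f, coeFn_fourier_freeU t g,
    Lp.coeFn_sub (𝓕 (freeU t f) : L2R) (𝓕 (freeU t g)),
    Lp.coeFn_sub (𝓕 f : L2R) (𝓕 g)] with ξ h₁ h₂ h₃ h₄
  rw [h₃, h₄, Pi.sub_apply, Pi.sub_apply, h₁, h₂, ← mul_sub, norm_mul, norm_freeSymbol, one_mul]

/-! ### Duality between the `L²` and integral Fourier transforms. -/

theorem integral_fourier_mul (f : L2R) (g : 𝓢(ℝ, ℂ)) :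
    ∫ x, (𝓕 f : L2R) x * g x = ∫ x, f x * 𝓕 g x := by
  have h := DFunLike.congr_fun (Lp.fourier_toTemperedDistribution_eq f) g
  rw [TemperedDistribution.fourier_apply, Lp.toTemperedDistribution_apply,
    Lp.toTemperedDistribution_apply] at h
  simp only [smul_eq_mul, mul_comm] at h ⊢
  exact h.symm

theorem integral_fourierInv_mul (f : L2R) (g : 𝓢(ℝ, ℂ)) :
    ∫ x, (𝓕⁻ f : L2R) x * g x = ∫ x, f x * 𝓕⁻ g x := by
  have h := integral_fourier_mul (𝓕⁻ f) (𝓕⁻ g)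
  rw [FourierTransform.fourier_fourierInv_eq, FourierTransform.fourier_fourierInv_eq] at h
  exact h.symm

theorem integral_fourier_mul_of_integrable {f g : ℝ → ℂ} (hf : Integrable f) (hg : Integrable g) :
    ∫ x, 𝓕 f x * g x = ∫ x, f x * 𝓕 g x := by
  simpa using! VectorFourier.integral_fourierIntegral_smul_eq_flip (L := innerₗ ℝ)
    Real.continuous_fourierChar continuous_inner hf hg

theorem ae_eq_of_forall_integral_mul_schwartz_eq {f g : ℝ → ℂ} (hf : LocallyIntegrable f)
    (hg : LocallyIntegrable g) (h : ∀ θ : 𝓢(ℝ, ℂ), ∫ x, f x * θ x = ∫ x, g x * θ x) :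
    f =ᵐ[volume] g := by
  refine ae_eq_of_integral_contDiff_smul_eq hf hg fun θ hθ hc => ?_
  have h₁ : HasCompactSupport fun x => (θ x : ℂ) :=
    hc.comp_left (g := ((↑) : ℝ → ℂ)) Complex.ofReal_zero
  have h₂ : ContDiff ℝ (⊤ : ℕ∞) fun x => (θ x : ℂ) := Complex.ofRealCLM.contDiff.comp hθ
  have := h (h₁.toSchwartzMap h₂)
  simpa [mul_comm] using this

theorem locallyIntegrable_L2 (f : L2R) : LocallyIntegrable f :=
  (Lp.memLp f).locallyIntegrable (by norm_num)

theorem coeFn_fourier_of_integrable (f : L2R) (hf : Integrable f) :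
    (𝓕 f : L2R) =ᵐ[volume] 𝓕 (f : ℝ → ℂ) := by
  have hc : Continuous (𝓕 (f : ℝ → ℂ)) :=
    VectorFourier.fourierIntegral_continuous Real.continuous_fourierChar continuous_inner hf
  refine ae_eq_of_forall_integral_mul_schwartz_eq (locallyIntegrable_L2 _)
    hc.locallyIntegrable fun θ => ?_
  rw [integral_fourier_mul, integral_fourier_mul_of_integrable hf θ.integrable]
  rfl

/-! ### The Schrödinger kernel and the factorization of the free group. -/

/-- Multiplication of a Schwartz function by the free symbol. -/
noncomputable def freeSymbolMul (t : ℝ) (θ : 𝓢(ℝ, ℂ)) : 𝓢(ℝ, ℂ) :=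
  SchwartzMap.smulLeftCLM ℂ (freeSymbol t) θ

@[simp]
theorem freeSymbolMul_apply (t : ℝ) (θ : 𝓢(ℝ, ℂ)) (ξ : ℝ) :
    freeSymbolMul t θ ξ = freeSymbol t ξ * θ ξ :=
  SchwartzMap.smulLeftCLM_apply_apply (freeSymbol_hasTemperateGrowth t) θ ξ

theorem integral_freeU_mul (t : ℝ) (f : L2R) (g : 𝓢(ℝ, ℂ)) :
    ∫ x, freeU t f x * g x = ∫ x, f x * 𝓕 (freeSymbolMul t (𝓕⁻ g)) x := by
  rw [freeU, integral_fourierInv_mul, ← integral_fourier_mul]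
  refine integral_congr_ae ?_
  filter_upwards [(memLp_freeSymbol_mul t (𝓕 f)).coeFn_toLp] with ξ h
  rw [h, freeSymbolMul_apply]
  ring

/-- The condition `0 < b.re` makes the Gaussian integrable, so the Fourier transform can be moved
onto it. This is the regularized form of the kernel formula; the free evolution is the boundary case
`b.re = 0`. -/
theorem integral_gaussian_mul_fourierInv (g : 𝓢(ℝ, ℂ)) (y : ℝ) {b : ℂ} (hb : 0 < b.re) :
    ∫ ξ : ℝ, Complex.exp (-Real.pi * b * ξ ^ 2 + 2 * Real.pi * (-Complex.I * y) * ξ) * 𝓕⁻ g ξ =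
      ∫ x : ℝ, 1 / b ^ (1 / 2 : ℂ) * Complex.exp (-Real.pi / b * (y - x) ^ 2) * g x := by
  have h₀ : Integrable fun ξ : ℝ =>
      Complex.exp (-Real.pi * b * ξ ^ 2 + 2 * Real.pi * (-Complex.I * y) * ξ) := by
    have : 0 < (Real.pi * b).re := by
      rw [Complex.re_ofReal_mul]
      exact mul_pos Real.pi_pos hb
    simpa [neg_mul] using integrable_cexp_quadratic this (2 * Real.pi * (-Complex.I * y)) 0
  have hg : Integrable fun x => g (-x) := g.integrable.comp_neg
  have h := integral_fourier_mul_of_integrable h₀ hg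
  rw [fourier_gaussian_pi' hb] at h
  have h₁ : ∀ ξ, 𝓕⁻ g ξ = 𝓕 (fun x => g (-x)) ξ := fun ξ => by
    rw [SchwartzMap.fourierInv_coe, Real.fourierInv_eq_fourier_comp_neg]
  simp_rw [h₁]
  rw [← h, ← integral_neg_eq_self]
  refine integral_congr_ae (Eventually.of_forall fun x => ?_)
  simp only [neg_neg, Complex.ofReal_neg]
  congr 4
  linear_combination (- (y:ℂ) * (2 * (-x) + y - y * Complex.I ^ 2)) * Complex.I_sq

/-- The constant of the free Schroedinger kernel. -/
noncomputable def kernelConst (t : ℝ) : ℂ := 1 / (2 * Real.pi * t * Complex.I) ^ (1 / 2 : ℂ)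

/-- The quadratic phase `e^{ix²/2t}`. -/
noncomputable def chirp (t x : ℝ) : ℂ :=
  Complex.exp (((x ^ 2 / (2 * t) : ℝ) : ℂ) * Complex.I)

@[simp]
theorem norm_chirp (t x : ℝ) : ‖chirp t x‖ = 1 :=
  Complex.norm_exp_ofReal_mul_I _

theorem measurable_chirp (t : ℝ) : Measurable (chirp t) := by
  unfold chirp
  fun_prop

theorem norm_exp_neg_pi_div_le {b : ℂ} (hb : 0 < b.re) (x : ℝ) :
    ‖Complex.exp (-Real.pi / b * (x : ℂ) ^ 2)‖ ≤ 1 := by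
  rw [Complex.norm_exp, Real.exp_le_one_iff]
  have : (-Real.pi / b * (x : ℂ) ^ 2) = ((-Real.pi * x ^ 2 : ℝ) : ℂ) * b⁻¹ := by
    push_cast
    ring
  rw [this, Complex.re_ofReal_mul, Complex.inv_re]
  have : 0 ≤ b.re / Complex.normSq b := div_nonneg hb.le (Complex.normSq_nonneg _)
  have : 0 ≤ Real.pi * x ^ 2 := mul_nonneg Real.pi_pos.le (sq_nonneg _)
  nlinarith

/-- Take `b = ε + 2πit` in the regularized identity and let `ε → 0⁺`, by dominated convergence on
both sides. Since `t ≠ 0`, the point `2πit` lies in the slit plane, where the square root is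
continuous. -/
theorem fourier_freeSymbolMul_fourierInv {t : ℝ} (ht : t ≠ 0) (g : 𝓢(ℝ, ℂ)) (y : ℝ) :
    𝓕 (freeSymbolMul t (𝓕⁻ g)) y = ∫ x : ℝ, kernelConst t * chirp t (y - x) * g x := by
  set b : ℝ → ℂ := fun ε => ε + 2 * Real.pi * t * Complex.I with hb_def
  have hb0 : b 0 = 2 * Real.pi * t * Complex.I := by simp [hb_def]
  have hbc : Continuous b := by fun_prop
  have hbne : b 0 ≠ 0 := by
    rw [hb0]
    simp [ht, Real.pi_ne_zero]
  have hbre : ∀ ε, (b ε).re = ε := fun ε => by simp [hb_def]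
  have hslit : b 0 ∈ Complex.slitPlane := by
    rw [Complex.mem_slitPlane_iff, hb0]
    right
    simp [ht, Real.pi_ne_zero]
  have hbt : Tendsto b (𝓝[>] 0) (𝓝 (b 0)) := hbc.continuousAt.mono_left nhdsWithin_le_nhds
  have hpos : ∀ᶠ ε : ℝ in 𝓝[>] 0, 0 < (b ε).re := by
    filter_upwards [self_mem_nhdsWithin] with ε hε
    rw [hbre]
    exact hε
  have hL : Tendsto (fun ε : ℝ => ∫ ξ : ℝ, Complex.exp (-Real.pi * b ε * ξ ^ 2 +
      2 * Real.pi * (-Complex.I * y) * ξ) * 𝓕⁻ g ξ) (𝓝[>] 0)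
      (𝓝 (∫ ξ : ℝ, Complex.exp (-Real.pi * b 0 * ξ ^ 2 +
        2 * Real.pi * (-Complex.I * y) * ξ) * 𝓕⁻ g ξ)) := by
    refine tendsto_integral_filter_of_dominated_convergence (fun ξ => ‖𝓕⁻ g ξ‖) ?_ ?_
      (𝓕⁻ g).integrable.norm ?_
    · refine Eventually.of_forall fun ε => Continuous.aestronglyMeasurable ?_
      exact Continuous.mul (by fun_prop) (𝓕⁻ g).continuous
    · filter_upwards [hpos] with ε hε
      refine Eventually.of_forall fun ξ => ?_
      rw [norm_mul]
      refine mul_le_of_le_one_left (norm_nonneg _) ?_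
      rw [Complex.norm_exp, Real.exp_le_one_iff]
      have : (-Real.pi * b ε * ξ ^ 2 + 2 * Real.pi * (-Complex.I * y) * ξ : ℂ) =
          ((-(Real.pi * ξ ^ 2) : ℝ) : ℂ) * b ε + ((-(2 * Real.pi * y * ξ) : ℝ) : ℂ) * Complex.I := by
        push_cast
        ring
      rw [this, Complex.add_re, Complex.re_ofReal_mul, Complex.re_ofReal_mul, Complex.I_re]
      have : 0 ≤ Real.pi * ξ ^ 2 := mul_nonneg Real.pi_pos.le (sq_nonneg _)
      nlinarith
    · refine Eventually.of_forall fun ξ => Tendsto.mul_const _ ?_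
      refine (Complex.continuous_exp.tendsto _).comp ?_
      exact ((hbt.const_mul _).mul_const _).add_const _
  have hR : Tendsto (fun ε : ℝ => ∫ x : ℝ, 1 / b ε ^ (1 / 2 : ℂ) *
      Complex.exp (-Real.pi / b ε * (y - x) ^ 2) * g x) (𝓝[>] 0)
      (𝓝 (∫ x : ℝ, 1 / b 0 ^ (1 / 2 : ℂ) *
        Complex.exp (-Real.pi / b 0 * (y - x) ^ 2) * g x)) := by
    simp_rw [mul_assoc, integral_const_mul]
    refine Tendsto.mul ?_ ?_
    · refine Tendsto.div tendsto_const_nhds ?_ ?_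
      · exact hbt.cpow tendsto_const_nhds hslit
      · rw [Ne, Complex.cpow_eq_zero_iff]
        exact fun h => hbne h.1
    · refine tendsto_integral_filter_of_dominated_convergence (fun x => ‖g x‖) ?_ ?_
        g.integrable.norm ?_
      · refine Eventually.of_forall fun ε => Continuous.aestronglyMeasurable ?_
        exact Continuous.mul (by fun_prop) g.continuous
      · filter_upwards [hpos] with ε hε
        refine Eventually.of_forall fun x => ?_
        rw [norm_mul]
        refine mul_le_of_le_one_left (norm_nonneg _) ?_
        exact_mod_cast norm_exp_neg_pi_div_le hε (y - x)
      · refine Eventually.of_forall fun x => Tendsto.mul_const _ ?_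
        refine (Complex.continuous_exp.tendsto _).comp ?_
        exact (tendsto_const_nhds.div hbt hbne).mul_const _
  have hLR := tendsto_nhds_unique hL (hR.congr' (by
    filter_upwards [hpos] with ε hε
    exact (integral_gaussian_mul_fourierInv g y hε).symm))
  rw [hb0] at hLR
  rw [SchwartzMap.fourier_coe, Real.fourier_real_eq_integral_exp_smul]
  convert! hLR using 3 with ξ x
  · rw [freeSymbolMul_apply, freeSymbol, smul_eq_mul, ← mul_assoc, ← Complex.exp_add]
    congr 2
    push_cast
    ring
  · rw [kernelConst, chirp]
    congr 3
    have : (t : ℂ) ≠ 0 := by exact_mod_cast ht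
    have : (Real.pi : ℂ) ≠ 0 := by exact_mod_cast Real.pi_ne_zero
    push_cast
    field_simp
    linear_combination ((y:ℂ) - x) ^ 2 * Complex.I_sq

/-- Expanding `(x - y)² / 2t`, the cross term `-xy/t` is the Fourier character at frequency `x /
(2πt)`. This produces the dilation in the factorization. -/
theorem chirp_sub {t : ℝ} (ht : t ≠ 0) (x y : ℝ) :
    chirp t (x - y) = chirp t x *
      (Complex.exp (((-2 * Real.pi * y * (x / (2 * Real.pi * t)) : ℝ) : ℂ) * Complex.I) *
        chirp t y) := by
  rw [chirp, chirp, chirp, ← Complex.exp_add, ← Complex.exp_add, ← add_mul, ← add_mul,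
    ← Complex.ofReal_add, ← Complex.ofReal_add]
  congr 3
  have := Real.pi_ne_zero
  field_simp
  ring

theorem integral_kernel_eq {t : ℝ} (ht : t ≠ 0) (f : ℝ → ℂ) (x : ℝ) :
    ∫ y : ℝ, kernelConst t * chirp t (x - y) * f y =
      kernelConst t * chirp t x * 𝓕 (fun y => chirp t y * f y) (x / (2 * Real.pi * t)) := by
  rw [Real.fourier_real_eq_integral_exp_smul, ← integral_const_mul]
  refine integral_congr_ae (Eventually.of_forall fun y => ?_)
  simp only [smul_eq_mul]
  rw [chirp_sub ht]
  ring

theorem integrable_chirp_mul (t : ℝ) {f : ℝ → ℂ} (hf : Integrable f) :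
    Integrable fun y => chirp t y * f y :=
  hf.bdd_mul (measurable_chirp t).aestronglyMeasurable
    (Eventually.of_forall fun y => (norm_chirp t y).le)

theorem continuous_fourier_of_integrable {f : ℝ → ℂ} (hf : Integrable f) : Continuous (𝓕 f) :=
  VectorFourier.fourierIntegral_continuous Real.continuous_fourierChar continuous_inner hf

/-- Both sides are tested against Schwartz functions: duality moves `freeU` onto the test function,
where the kernel is known, and Fubini with the symmetry of the kernel moves it back. -/
theorem freeU_ae_eq {t : ℝ} (ht : t ≠ 0) (f : L2R) (hf : Integrable f) :
    freeU t f =ᵐ[volume] fun x =>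
      kernelConst t * chirp t x * 𝓕 (fun y => chirp t y * f y) (x / (2 * Real.pi * t)) := by
  have hc : Continuous (fun x =>
      kernelConst t * chirp t x * 𝓕 (fun y => chirp t y * f y) (x / (2 * Real.pi * t))) := by
    have h₁ : Continuous (chirp t) := by
      unfold chirp
      fun_prop
    exact (continuous_const.mul h₁).mul
      ((continuous_fourier_of_integrable (integrable_chirp_mul t hf)).comp (by fun_prop))
  refine ae_eq_of_forall_integral_mul_schwartz_eq (locallyIntegrable_L2 _)
    hc.locallyIntegrable fun θ => ?_
  rw [integral_freeU_mul]
  simp_rw [fourier_freeSymbolMul_fourierInv ht, ← integral_kernel_eq ht, ← integral_const_mul,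
    ← integral_mul_const]
  have hmeas : Measurable fun z : ℝ × ℝ => chirp t (z.1 - z.2) :=
    (measurable_chirp t).comp (measurable_fst.sub measurable_snd)
  have hint : Integrable (fun z : ℝ × ℝ => kernelConst t * chirp t (z.1 - z.2) * (f z.1 * θ z.2))
      (volume.prod volume) :=
    (hf.mul_prod θ.integrable).bdd_mul (c := ‖kernelConst t‖)
      (measurable_const.mul hmeas).aestronglyMeasurable
      (Eventually.of_forall fun z => by simp)
  have hneg : ∀ x y, chirp t (x - y) = chirp t (y - x) := fun x y => by
    rw [chirp, chirp, ← neg_sub x y, neg_sq]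
  rw [integral_integral_swap]
  · refine integral_congr_ae (Eventually.of_forall fun x => integral_congr_ae
      (Eventually.of_forall fun y => ?_))
    simp only
    rw [hneg]
    ring
  · refine hint.congr (Eventually.of_forall fun z => ?_)
    simp only [Function.uncurry]
    ring

/-! ### Cauchy–Schwarz, dilations and weighted norms. -/

theorem integrable_mul_L2 (f g : L2R) : Integrable fun x => f x * g x :=
  (Lp.memLp f).integrable_mul (Lp.memLp g)

theorem integrable_norm_mul_norm_L2 (f g : L2R) : Integrable fun x => ‖f x‖ * ‖g x‖ := by
  simpa only [norm_mul] using (integrable_mul_L2 f g).norm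

theorem integral_norm_mul_norm_le (f g : L2R) : ∫ x, ‖f x‖ * ‖g x‖ ≤ ‖f‖ * ‖g‖ := by
  simp_rw [← norm_mul]
  rw [integral_norm_eq_lintegral_enorm (integrable_mul_L2 f g).1, Lp.norm_def, Lp.norm_def,
    ← ENNReal.toReal_mul]
  refine ENNReal.toReal_mono (ENNReal.mul_ne_top (Lp.eLpNorm_ne_top f) (Lp.eLpNorm_ne_top g)) ?_
  have h := eLpNorm_smul_le_mul_eLpNorm (p := 2) (q := 2) (r := 1) (Lp.aestronglyMeasurable g)
    (Lp.aestronglyMeasurable f)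
  rw [eLpNorm_one_eq_lintegral_enorm] at h
  exact h

theorem map_div_volume {a : ℝ} (ha : a ≠ 0) :
    Measure.map (fun x : ℝ => x / a) volume = ENNReal.ofReal |a| • volume := by
  simp_rw [div_eq_mul_inv]
  rw [Real.map_volume_mul_right (inv_ne_zero ha), inv_inv]

theorem ae_comp_div {a : ℝ} (ha : a ≠ 0) {p : ℝ → Prop} (h : ∀ᵐ x : ℝ, p x) :
    ∀ᵐ x : ℝ, p (x / a) := by
  have hq : Measure.QuasiMeasurePreserving (fun x : ℝ => x / a) volume volume :=
    ⟨by fun_prop, by rw [map_div_volume ha]; exact Measure.smul_absolutelyContinuous⟩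
  exact hq.ae h

theorem ae_comp_div_iff {a : ℝ} (ha : a ≠ 0) {p : ℝ → Prop} :
    (∀ᵐ x : ℝ, p (x / a)) ↔ ∀ᵐ x : ℝ, p x := by
  refine ⟨fun h => ?_, ae_comp_div ha⟩
  filter_upwards [ae_comp_div (inv_ne_zero ha) h] with x hx
  rwa [div_inv_eq_mul, mul_div_cancel_right₀ _ ha] at hx

/-- This is Plancherel for `hat`: the Jacobian of the dilation contributes `√(2π)` to the `L²` norm
and cancels the normalizing constant. -/
theorem enorm_le_eLpNorm_hat (φ : L2R) : ‖φ‖ₑ ≤ eLpNorm (hat φ) 2 volume := by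
  have h2 : (0 : ℝ) < 2 * Real.pi := by positivity
  have hs : (0 : ℝ) < √(2 * Real.pi) := Real.sqrt_pos.2 h2
  have he : MeasurableEmbedding (fun x : ℝ => x / (2 * Real.pi)) := by
    simpa only [div_eq_mul_inv] using measurableEmbedding_mulRight₀ (inv_ne_zero h2.ne')
  have h₁ : hat φ = (((√(2 * Real.pi))⁻¹ : ℝ) : ℂ) •
      ((𝓕 φ : L2R) ∘ fun x : ℝ => x / (2 * Real.pi)) := rfl
  rw [h₁, eLpNorm_const_smul, ← he.eLpNorm_map_measure, map_div_volume h2.ne',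
    eLpNorm_smul_measure_of_ne_top (by norm_num), smul_eq_mul, ← mul_assoc, abs_of_pos h2]
  have h₃ : ‖(((√(2 * Real.pi))⁻¹ : ℝ) : ℂ)‖ₑ *
      ENNReal.ofReal (2 * Real.pi) ^ ((1 : ℝ≥0∞) / 2).toReal = 1 := by
    rw [ENNReal.ofReal_rpow_of_pos h2, ← ofReal_norm, ← ENNReal.ofReal_mul (norm_nonneg _),
      Complex.norm_real, Real.norm_of_nonneg (inv_nonneg.2 hs.le)]
    simp only [one_div, ENNReal.toReal_inv, ENNReal.toReal_ofNat]
    rw [← one_div 2, ← Real.sqrt_eq_rpow, inv_mul_cancel₀ hs.ne', ENNReal.ofReal_one]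
  rw [h₃, one_mul, ← Lp.enorm_def, ← ofReal_norm, ← ofReal_norm,
    Lp.norm_fourier_eq]

theorem one_le_jb (x : ℝ) : 1 ≤ jb x := by
  rw [jb, Real.one_le_sqrt]
  nlinarith [sq_nonneg x]

theorem continuous_jb : Continuous jb := by
  unfold jb
  fun_prop

theorem enorm_le_sobolevNorm (φ : L2R) : ‖φ‖ₑ ≤ sobolevNorm 1 φ := by
  refine (enorm_le_eLpNorm_hat φ).trans (eLpNorm_mono fun ξ => ?_)
  rw [norm_mul, Complex.norm_real, Real.rpow_one, Real.norm_of_nonneg (by linarith [one_le_jb ξ])]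
  exact le_mul_of_one_le_left (norm_nonneg _) (one_le_jb ξ)

theorem memLp_jb_rpow_neg : MemLp (fun x => ((jb x ^ (-(3 / 4) : ℝ) : ℝ) : ℂ)) 2 volume := by
  have hm : Continuous fun x => ((jb x ^ (-(3 / 4) : ℝ) : ℝ) : ℂ) :=
    Complex.continuous_ofReal.comp
      (continuous_jb.rpow_const fun x => Or.inl (by linarith [one_le_jb x]))
  rw [memLp_two_iff_integrable_sq_norm hm.aestronglyMeasurable]
  have h := integrable_rpow_neg_one_add_norm_sq (E := ℝ) (μ := volume) (r := 3 / 2)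
    (by rw [Module.finrank_self]; norm_num)
  refine h.congr (Eventually.of_forall fun x => ?_)
  have h0 : 0 ≤ 1 + x ^ 2 := by positivity
  simp only [Complex.norm_real, Real.norm_eq_abs, sq_abs]
  rw [jb, Real.sqrt_eq_rpow, ← Real.rpow_mul h0, ← Real.rpow_mul_natCast h0]
  norm_num

/-- The weight `⟨x⟩^{-3/4}` as an element of `L²`. -/
noncomputable def jbWeight : L2R := memLp_jb_rpow_neg.toLp

/-- Cauchy–Schwarz with `⟨x⟩^{1/4} = ⟨x⟩^{-3/4} ⟨x⟩`. The first factor is in `L²` because `3/2 > 1`;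
the spare power `1/4` pays for replacing the quadratic phase by `1`. -/
theorem weighted_L1_bound (f : L2R) (h : MemLp (fun x => ((jb x ^ (1 : ℝ) : ℝ) : ℂ) * f x) 2 volume) :
    Integrable (fun x => jb x ^ (1 / 4 : ℝ) * ‖f x‖) ∧
      ∫ x, jb x ^ (1 / 4 : ℝ) * ‖f x‖ ≤ ‖jbWeight‖ * ‖h.toLp‖ := by
  have he : (fun x => ‖jbWeight x‖ * ‖(h.toLp : L2R) x‖) =ᵐ[volume]
      fun x => jb x ^ (1 / 4 : ℝ) * ‖f x‖ := by
    filter_upwards [memLp_jb_rpow_neg.coeFn_toLp, h.coeFn_toLp] with x h₁ h₂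
    have hp : 0 < jb x := by linarith [one_le_jb x]
    rw [jbWeight, h₁, h₂, norm_mul, Complex.norm_real, Complex.norm_real,
      Real.norm_of_nonneg (Real.rpow_nonneg hp.le _), Real.norm_of_nonneg (Real.rpow_nonneg hp.le _),
      ← mul_assoc, ← Real.rpow_add hp]
    norm_num
  refine ⟨(integrable_norm_mul_norm_L2 _ _).congr he, ?_⟩
  rw [← integral_congr_ae he]
  exact integral_norm_mul_norm_le _ _

/-- Interpolation between the bounds `|a|` and `2`. With `a = x²/2t`, the exponent `1/8` costs
exactly the weight `⟨x⟩^{1/4}` and gains `t^{-1/8}`. -/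
theorem norm_exp_ofReal_mul_I_sub_one_le_rpow (a : ℝ) :
    ‖Complex.exp (a * Complex.I) - 1‖ ≤ 2 * |a| ^ (1 / 8 : ℝ) := by
  rcases le_total |a| 1 with h | h
  · have h₁ : ‖Complex.exp (a * Complex.I) - 1‖ ≤ |a| := by
      rw [mul_comm]
      exact Real.norm_exp_I_mul_ofReal_sub_one_le
    have h₂ : |a| ≤ |a| ^ (1 / 8 : ℝ) :=
      Real.self_le_rpow_of_le_one (abs_nonneg a) h (by norm_num)
    have h₃ : 0 ≤ |a| := abs_nonneg a
    linarith
  · have h₁ : ‖Complex.exp (a * Complex.I) - 1‖ ≤ 2 := by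
      refine (norm_sub_le _ _).trans ?_
      rw [Complex.norm_exp_ofReal_mul_I, norm_one]
      norm_num
    have h₂ : 1 ≤ |a| ^ (1 / 8 : ℝ) := Real.one_le_rpow h (by norm_num)
    linarith

theorem norm_chirp_sub_one_le {t : ℝ} (ht : 0 < t) (x : ℝ) :
    ‖chirp t x - 1‖ ≤ 2 * t ^ (-(1 / 8) : ℝ) * jb x ^ (1 / 4 : ℝ) := by
  refine (norm_exp_ofReal_mul_I_sub_one_le_rpow _).trans ?_
  rw [mul_assoc]
  gcongr
  have h0 : 0 ≤ 1 + x ^ 2 := by positivity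
  have h : jb x ^ (1 / 4 : ℝ) = (1 + x ^ 2) ^ (1 / 8 : ℝ) := by
    rw [jb, Real.sqrt_eq_rpow, ← Real.rpow_mul h0]
    norm_num
  rw [h, Real.rpow_neg ht.le, ← Real.inv_rpow ht.le, ← Real.mul_rpow (by positivity) h0]
  refine Real.rpow_le_rpow (abs_nonneg _) ?_ (by norm_num)
  rw [abs_of_nonneg (by positivity), div_le_iff₀ (by positivity)]
  field_simp
  nlinarith [sq_nonneg x]

theorem norm_fourier_sub_le {f g : ℝ → ℂ} (hf : Integrable f) (hg : Integrable g) (s : ℝ) :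
    ‖𝓕 f s - 𝓕 g s‖ ≤ ∫ y, ‖f y - g y‖ := by
  rw [Real.fourier_real_eq_integral_exp_smul, Real.fourier_real_eq_integral_exp_smul,
    ← integral_sub]
  · refine (norm_integral_le_integral_norm _).trans (le_of_eq ?_)
    refine integral_congr_ae (Eventually.of_forall fun y => ?_)
    simp only [← smul_sub]
    rw [norm_smul, Complex.norm_exp_ofReal_mul_I, one_mul]
  · refine hf.bdd_mul (c := 1) (Continuous.aestronglyMeasurable (by fun_prop))
      (Eventually.of_forall fun y => (Complex.norm_exp_ofReal_mul_I _).le)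
  · refine hg.bdd_mul (c := 1) (Continuous.aestronglyMeasurable (by fun_prop))
      (Eventually.of_forall fun y => (Complex.norm_exp_ofReal_mul_I _).le)

theorem norm_fourier_le_of_hat_bounded (φ : L2R) {C : ℝ}
    (h : ∀ᵐ ξ, ‖hat φ ξ‖ ≤ C) : ∀ᵐ s, ‖(𝓕 φ : L2R) s‖ ≤ √(2 * Real.pi) * C := by
  have h2 : (2 * Real.pi) ≠ 0 := by positivity
  have hs : (0 : ℝ) < √(2 * Real.pi) := Real.sqrt_pos.2 (by positivity)
  rw [← ae_comp_div_iff h2]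
  filter_upwards [h] with ξ hξ
  rw [hat, norm_mul, Complex.norm_real, Real.norm_of_nonneg (inv_nonneg.2 hs.le),
    inv_mul_le_iff₀ hs] at hξ
  exact hξ

theorem exists_ae_norm_le_of_eLpNorm_top_lt {f : ℝ → ℂ} {C : ℝ≥0∞} (hC : C ≠ ∞)
    (h : eLpNorm f ∞ volume ≤ C) : ∀ᵐ x, ‖f x‖ ≤ C.toReal := by
  rw [eLpNorm_exponent_top] at h
  filter_upwards [ae_le_eLpNormEssSup (f := f) (μ := volume)] with x hx
  rw [← toReal_enorm]
  exact ENNReal.toReal_mono hC (hx.trans h)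

/-! ### Boundedness and convergence of the profiles. -/

/-- Without the phase, the transform is bounded by hypothesis. Inserting the phase changes it
uniformly by at most a constant times `t^{-1/8}` times the weighted norm, which is `O(t^γ)`; this is
where `γ ≤ 1/8` enters. -/
theorem ProfileBounded.exists_bound {T₀ γ : ℝ} {u : ℝ → L2R} (hT₀ : 1 ≤ T₀) (hγ : γ ≤ 1 / 8)
    (h : ProfileBounded T₀ γ u) :
    ∃ C : ℝ, 0 ≤ C ∧ ∀ t, T₀ ≤ t → Integrable (freeU (-t) (u t)) ∧
      ∀ᵐ s, ‖𝓕 (fun y => chirp t y * freeU (-t) (u t) y) s‖ ≤ C := by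
  set B : ℝ≥0∞ := ⨆ t ∈ Set.Ici T₀,
    (ENNReal.ofReal (t ^ (-γ)) * weightedSobolevNorm 1 1 (freeU (-t) (u t))
      + eLpNorm (hat (freeU (-t) (u t))) ∞ volume) with hB
  have hBtop : B ≠ ∞ := h.ne
  refine ⟨√(2 * Real.pi) * B.toReal + 2 * ‖jbWeight‖ * B.toReal, by positivity, fun t ht => ?_⟩
  have ht0 : 0 < t := by linarith
  set f := freeU (-t) (u t) with hf
  have hle : ENNReal.ofReal (t ^ (-γ)) * weightedSobolevNorm 1 1 f
      + eLpNorm (hat f) ∞ volume ≤ B :=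
    le_iSup₂ (f := fun t (_ : t ∈ Set.Ici T₀) =>
      ENNReal.ofReal (t ^ (-γ)) * weightedSobolevNorm 1 1 (freeU (-t) (u t))
        + eLpNorm (hat (freeU (-t) (u t))) ∞ volume) t ht
  have hle₁ := le_self_add.trans hle
  have hle₂ := le_add_self.trans hle
  have htγ : 0 < t ^ (-γ) := Real.rpow_pos_of_pos ht0 _
  -- Otherwise the weighted norm is `∞`, and its product with the positive factor `t ^ (-γ)` would
  -- exceed the finite supremum.
  have hmem : MemLp (fun x => ((jb x ^ (1 : ℝ) : ℝ) : ℂ) * f x) 2 volume := by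
    by_contra hn
    rw [weightedSobolevNorm, dif_neg hn, ENNReal.mul_top (by simpa using htγ), top_le_iff] at hle₁
    exact hBtop hle₁
  have hnorm : t ^ (-γ) * ‖hmem.toLp‖ ≤ B.toReal := by
    rw [weightedSobolevNorm, dif_pos hmem] at hle₁
    have := (mul_le_mul_right (enorm_le_sobolevNorm hmem.toLp) _).trans hle₁
    have := ENNReal.toReal_mono hBtop this
    rwa [ENNReal.toReal_mul, ENNReal.toReal_ofReal htγ.le, toReal_enorm] at this
  obtain ⟨hw, hwle⟩ := weighted_L1_bound f hmem
  have hfint : Integrable f := by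
    refine hw.mono (Lp.aestronglyMeasurable f) (Eventually.of_forall fun x => ?_)
    rw [norm_mul, norm_norm]
    refine le_mul_of_one_le_left (norm_nonneg _) ?_
    have := Real.one_le_rpow (one_le_jb x) (by norm_num : (0 : ℝ) ≤ 1 / 4)
    rwa [Real.norm_of_nonneg (by linarith)]
  refine ⟨hfint, ?_⟩
  filter_upwards [coeFn_fourier_of_integrable f hfint, norm_fourier_le_of_hat_bounded f
    (exists_ae_norm_le_of_eLpNorm_top_lt hBtop hle₂)] with s h₁ h₂
  rw [h₁] at h₂
  have hd := norm_fourier_sub_le (integrable_chirp_mul t hfint) hfint s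
  have hd₂ : ∫ y, ‖chirp t y * f y - f y‖ ≤
      ∫ y, 2 * t ^ (-(1 / 8) : ℝ) * (jb y ^ (1 / 4 : ℝ) * ‖f y‖) := by
    refine integral_mono ((integrable_chirp_mul t hfint).sub hfint).norm (hw.const_mul _)
      fun y => ?_
    have : chirp t y * f y - f y = (chirp t y - 1) * f y := by ring
    simp only [this, norm_mul, ← mul_assoc]
    exact mul_le_mul_of_nonneg_right (norm_chirp_sub_one_le ht0 y) (norm_nonneg _)
  rw [integral_const_mul] at hd₂
  have hd₃ : 2 * t ^ (-(1 / 8) : ℝ) * ∫ y, jb y ^ (1 / 4 : ℝ) * ‖f y‖ ≤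
      2 * ‖jbWeight‖ * B.toReal := by
    have e₁ : t ^ (-(1 / 8) : ℝ) ≤ t ^ (-γ) :=
      Real.rpow_le_rpow_of_exponent_le (by linarith) (by linarith)
    calc 2 * t ^ (-(1 / 8) : ℝ) * ∫ y, jb y ^ (1 / 4 : ℝ) * ‖f y‖
        ≤ 2 * t ^ (-γ) * (‖jbWeight‖ * ‖hmem.toLp‖) :=
          mul_le_mul (by gcongr) hwle (integral_nonneg fun y => mul_nonneg
            (Real.rpow_nonneg (by linarith [one_le_jb y]) _) (norm_nonneg _)) (by positivity)
      _ = 2 * ‖jbWeight‖ * (t ^ (-γ) * ‖hmem.toLp‖) := by ring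
      _ ≤ 2 * ‖jbWeight‖ * B.toReal := by gcongr
  have := norm_le_norm_add_norm_sub' (𝓕 (fun y => chirp t y * f y) s) (𝓕 (f : ℝ → ℂ) s)
  linarith

theorem tendsto_chirp (y : ℝ) : Tendsto (fun t => chirp t y) atTop (𝓝 1) := by
  have h : Tendsto (fun t : ℝ => y ^ 2 / (2 * t)) atTop (𝓝 0) :=
    tendsto_const_nhds.div_atTop (tendsto_id.const_mul_atTop (by norm_num))
  have h₂ : Continuous fun a : ℝ => Complex.exp ((a : ℂ) * Complex.I) := by fun_prop
  simpa using! (h₂.tendsto 0).comp h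

theorem chirp_neg (t y : ℝ) : chirp (-t) y = starRingEnd ℂ (chirp t y) := by
  rw [chirp, chirp, ← Complex.exp_conj, map_mul, Complex.conj_I, Complex.conj_ofReal,
    mul_neg, mul_neg, div_neg, Complex.ofReal_neg, neg_mul]

theorem norm_chirp_sub_one_le_two (t y : ℝ) : ‖chirp t y - 1‖ ≤ 2 := by
  refine (norm_sub_le _ _).trans ?_
  rw [norm_chirp, norm_one]
  norm_num

theorem memLp_chirp_mul (t : ℝ) (f : L2R) : MemLp (fun y => chirp t y * f y) 2 volume :=
  (Lp.memLp f).of_le ((measurable_chirp t).aestronglyMeasurable.mul (Lp.aestronglyMeasurable f))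
    (Eventually.of_forall fun y => by rw [norm_mul, norm_chirp, one_mul])

/-- Multiplication of an `L²` function by the quadratic phase. -/
noncomputable def chirpMul (t : ℝ) (f : L2R) : L2R := (memLp_chirp_mul t f).toLp

theorem coeFn_chirpMul (t : ℝ) (f : L2R) : chirpMul t f =ᵐ[volume] fun y => chirp t y * f y :=
  (memLp_chirp_mul t f).coeFn_toLp

theorem norm_chirpMul_sub (t : ℝ) (f g : L2R) : ‖chirpMul t f - chirpMul t g‖ = ‖f - g‖ := by
  rw [Lp.norm_def, Lp.norm_def]
  congr 1
  apply eLpNorm_congr_norm_ae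
  filter_upwards [coeFn_chirpMul t f, coeFn_chirpMul t g, Lp.coeFn_sub (chirpMul t f) (chirpMul t g),
    Lp.coeFn_sub f g] with ξ h₁ h₂ h₃ h₄
  rw [h₃, h₄, Pi.sub_apply, Pi.sub_apply, h₁, h₂, ← mul_sub, norm_mul, norm_chirp, one_mul]

theorem L2_norm_sq_eq (f : L2R) : ‖f‖ ^ 2 = ∫ x, ‖f x‖ ^ 2 := by
  have h := L2.inner_def (𝕜 := ℂ) f f
  simp only [inner_self_eq_norm_sq_to_K] at h
  rw [← Complex.ofReal_inj, ← integral_complex_ofReal]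
  simpa using h

theorem integrable_norm_sq_L2 (f : L2R) : Integrable fun x => ‖f x‖ ^ 2 :=
  (memLp_two_iff_integrable_sq_norm (Lp.aestronglyMeasurable f)).1 (Lp.memLp f)

theorem tendsto_chirpMul (f : L2R) : Tendsto (fun t => chirpMul t f) atTop (𝓝 f) := by
  rw [tendsto_iff_norm_sub_tendsto_zero]
  have h : Tendsto (fun t => ∫ y, ‖(chirp t y - 1) * f y‖ ^ 2) atTop (𝓝 (∫ _ : ℝ, (0 : ℝ))) := by
    refine tendsto_integral_filter_of_dominated_convergence (fun y => 4 * ‖f y‖ ^ 2) ?_ ?_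
      ((integrable_norm_sq_L2 f).const_mul 4) ?_
    · refine Eventually.of_forall fun t => AEStronglyMeasurable.pow ?_ 2
      exact ((((measurable_chirp t).sub_const 1).aestronglyMeasurable).mul
        (Lp.aestronglyMeasurable f)).norm
    · refine Eventually.of_forall fun t => Eventually.of_forall fun y => ?_
      rw [norm_pow, norm_norm, norm_mul, mul_pow]
      have := norm_chirp_sub_one_le_two t y
      have := norm_nonneg (chirp t y - 1)
      gcongr
      nlinarith
    · refine Eventually.of_forall fun y => ?_
      have := ((((tendsto_chirp y).sub_const 1).mul_const (f y)).norm).pow 2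
      simpa using this
  have he : ∀ t, ‖chirpMul t f - f‖ = √(∫ y, ‖(chirp t y - 1) * f y‖ ^ 2) := fun t => by
    rw [eq_comm, Real.sqrt_eq_iff_eq_sq (integral_nonneg fun _ => by positivity) (norm_nonneg _),
      L2_norm_sq_eq]
    refine integral_congr_ae ?_
    filter_upwards [coeFn_chirpMul t f, Lp.coeFn_sub (chirpMul t f) f] with y h₁ h₂
    rw [h₂, Pi.sub_apply, h₁]
    congr 2
    ring
  simp_rw [he]
  simpa using h.sqrt

/-- The rescaled profile of the solution `u` at time `t`, as an element of `L²`. -/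
noncomputable def profile (u : ℝ → L2R) (t : ℝ) : L2R := 𝓕 (chirpMul t (freeU (-t) (u t)))

theorem coeFn_profile (u : ℝ → L2R) (t : ℝ) (h : Integrable (freeU (-t) (u t))) :
    profile u t =ᵐ[volume] 𝓕 (fun y => chirp t y * freeU (-t) (u t) y) := by
  have hint : Integrable (chirpMul t (freeU (-t) (u t))) :=
    (integrable_chirp_mul t h).congr (coeFn_chirpMul _ _).symm
  refine (coeFn_fourier_of_integrable _ hint).trans (Eventually.of_forall fun s => ?_)
  rw [Real.fourier_real_eq_integral_exp_smul, Real.fourier_real_eq_integral_exp_smul]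
  refine integral_congr_ae ?_
  filter_upwards [coeFn_chirpMul t (freeU (-t) (u t))] with y hy
  rw [hy]

/-- The phase and the free group preserve `L²` distances, so `chirp t * U(-t)u(t)` is as close to
`chirp t * ψ` as `u(t)` is to `U(t)ψ`. The phase tends to `1` strongly, and the Fourier transform is
continuous. -/
theorem ScattersTo.tendsto_profile {u : ℝ → L2R} {ψ : L2R} (h : ScattersTo u ψ) :
    Tendsto (profile u) atTop (𝓝 (𝓕 ψ)) := by
  have h₁ : Tendsto (fun t => chirpMul t (freeU (-t) (u t))) atTop (𝓝 ψ) := by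
    have h₂ : Tendsto (fun t => chirpMul t (freeU (-t) (u t)) - chirpMul t ψ) atTop (𝓝 0) := by
      rw [tendsto_zero_iff_norm_tendsto_zero]
      refine h.congr fun t => ?_
      rw [norm_chirpMul_sub, ← norm_freeU_sub t (freeU (-t) (u t)), freeU_freeU_neg]
    simpa using h₂.add (tendsto_chirpMul ψ)
  exact ((Lp.fourierTransformₗᵢ ℝ ℂ).continuous.tendsto ψ).comp h₁

/-! ### The trilinear limit. -/

/-- Convergence of the trilinear form `∫ |V₂|² V₁ W` for `L²`-convergent, uniformly bounded
factors `V₁`, `V₂` and a uniformly convergent factor `W`. -/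
theorem tendsto_integral_cubic_mul {V₁ V₂ : ℝ → L2R} {Ψ₁ Ψ₂ : L2R} {W : ℝ → ℝ → ℂ} {θ : ℝ → ℂ}
    {C : ℝ} {ε : ℝ → ℝ} (h₁ : Tendsto V₁ atTop (𝓝 Ψ₁)) (h₂ : Tendsto V₂ atTop (𝓝 Ψ₂))
    (hb₁ : ∀ᶠ t in atTop, ∀ᵐ s, ‖V₁ t s‖ ≤ C) (hb₂ : ∀ᶠ t in atTop, ∀ᵐ s, ‖V₂ t s‖ ≤ C)
    (hbΨ : ∀ᵐ s, ‖Ψ₁ s‖ ≤ C) (hWm : ∀ t, Continuous (W t)) (hθ : Continuous θ)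
    (hW : ∀ t s, ‖W t s‖ ≤ C) (hWθ : ∀ t s, ‖W t s - θ s‖ ≤ ε t) (hε : Tendsto ε atTop (𝓝 0)) :
    Tendsto (fun t => ∫ s, cubic (V₂ t) (V₁ t) s * W t s) atTop
      (𝓝 (∫ s, cubic Ψ₂ Ψ₁ s * θ s)) := by
  have hC : 0 ≤ C := (norm_nonneg _).trans (hW 0 0)
  have hcub : ∀ (V₁ V₂ : L2R) (w : ℝ → ℂ) (K : ℝ), (∀ᵐ s, ‖V₁ s‖ ≤ C) → Continuous w →
      (∀ s, ‖w s‖ ≤ K) → Integrable fun s => cubic V₂ V₁ s * w s := by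
    intro V₁ V₂ w K hV hw hK
    have e : (fun s => cubic V₂ V₁ s * w s) =
        fun s => (V₁ s * w s) * ((‖V₂ s‖ ^ 2 : ℝ) : ℂ) := by
      ext s
      rw [cubic]
      ring
    rw [e]
    refine (integrable_norm_sq_L2 V₂).ofReal.bdd_mul (c := C * K)
      ((Lp.aestronglyMeasurable V₁).mul hw.aestronglyMeasurable) ?_
    filter_upwards [hV] with s hs
    rw [norm_mul]
    exact mul_le_mul hs (hK s) (norm_nonneg _) hC
  rw [tendsto_iff_norm_sub_tendsto_zero]
  have hlim : Tendsto (fun t => C ^ 2 * (‖V₂ t‖ * ‖V₁ t - Ψ₁‖) +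
      C ^ 2 * (‖V₂ t‖ * ‖V₂ t - Ψ₂‖ + ‖Ψ₂‖ * ‖V₂ t - Ψ₂‖) + C * ε t * ‖Ψ₂‖ ^ 2) atTop (𝓝 0) := by
    have d₁ := tendsto_iff_norm_sub_tendsto_zero.1 h₁
    have d₂ := tendsto_iff_norm_sub_tendsto_zero.1 h₂
    have := (((h₂.norm.mul d₁).const_mul (C ^ 2)).add
      (((h₂.norm.mul d₂).add (d₂.const_mul ‖Ψ₂‖)).const_mul (C ^ 2))).add
      ((hε.const_mul C).mul_const (‖Ψ₂‖ ^ 2))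
    simpa using this
  refine squeeze_zero' (Eventually.of_forall fun t => norm_nonneg _) ?_ hlim
  filter_upwards [hb₁, hb₂] with t hb₁ hb₂
  have hεt : 0 ≤ ε t := (norm_nonneg _).trans (hWθ t 0)
  have hθb : ∀ s, ‖θ s‖ ≤ C + ε t := fun s => by
    have := norm_le_norm_add_norm_sub' (θ s) (W t s)
    rw [norm_sub_rev] at this
    linarith [hW t s, hWθ t s]
  rw [← integral_sub (hcub _ _ _ C hb₁ (hWm t) (hW t)) (hcub _ _ _ _ hbΨ hθ hθb)]
  have i₁ := integrable_norm_mul_norm_L2 (V₂ t) (V₁ t - Ψ₁)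
  have i₂ := integrable_norm_mul_norm_L2 (V₂ t) (V₂ t - Ψ₂)
  have i₃ := integrable_norm_mul_norm_L2 Ψ₂ (V₂ t - Ψ₂)
  have i₄ := (integrable_norm_sq_L2 Ψ₂).const_mul (C * ε t)
  have j₁ := i₁.const_mul (C ^ 2)
  have j₂ : Integrable fun s => C ^ 2 * (‖V₂ t s‖ * ‖(V₂ t - Ψ₂) s‖ +
      ‖Ψ₂ s‖ * ‖(V₂ t - Ψ₂) s‖) := (i₂.add i₃).const_mul _
  have j₃ : Integrable fun s => C ^ 2 * (‖V₂ t s‖ * ‖(V₁ t - Ψ₁) s‖) +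
      C ^ 2 * (‖V₂ t s‖ * ‖(V₂ t - Ψ₂) s‖ + ‖Ψ₂ s‖ * ‖(V₂ t - Ψ₂) s‖) := j₁.add j₂
  have hsum : ‖∫ s, (cubic (V₂ t) (V₁ t) s * W t s - cubic Ψ₂ Ψ₁ s * θ s)‖ ≤
      ∫ s, (C ^ 2 * (‖V₂ t s‖ * ‖(V₁ t - Ψ₁) s‖) +
      C ^ 2 * (‖V₂ t s‖ * ‖(V₂ t - Ψ₂) s‖ + ‖Ψ₂ s‖ * ‖(V₂ t - Ψ₂) s‖) +
      C * ε t * ‖Ψ₂ s‖ ^ 2) := by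
    refine norm_integral_le_of_norm_le (j₃.add i₄) ?_
    filter_upwards [hb₁, hb₂, hbΨ, Lp.coeFn_sub (V₁ t) Ψ₁, Lp.coeFn_sub (V₂ t) Ψ₂]
      with s b₁ b₂ b₃ e₁ e₂
    rw [e₁, e₂, Pi.sub_apply, Pi.sub_apply, cubic, cubic]
    -- Telescoping one factor at a time. In each term two factors are kept in `L²` and the other two
    -- are bounded uniformly, so no bound on `Ψ₂` is needed.
    have key : ((‖V₂ t s‖ ^ 2 : ℝ) : ℂ) * V₁ t s * W t s - ((‖Ψ₂ s‖ ^ 2 : ℝ) : ℂ) * Ψ₁ s * θ s =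
        ((‖V₂ t s‖ ^ 2 : ℝ) : ℂ) * (V₁ t s - Ψ₁ s) * W t s +
        (((‖V₂ t s‖ + ‖Ψ₂ s‖) * (‖V₂ t s‖ - ‖Ψ₂ s‖) : ℝ) : ℂ) * Ψ₁ s * W t s +
        ((‖Ψ₂ s‖ ^ 2 : ℝ) : ℂ) * Ψ₁ s * (W t s - θ s) := by
      push_cast
      ring
    rw [key]
    refine (norm_add₃_le).trans (add_le_add (add_le_add ?_ ?_) ?_)
    · rw [norm_mul, norm_mul, Complex.norm_real, norm_pow, norm_norm]
      calc ‖V₂ t s‖ ^ 2 * ‖V₁ t s - Ψ₁ s‖ * ‖W t s‖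
          = ‖V₂ t s‖ * ‖W t s‖ * (‖V₂ t s‖ * ‖V₁ t s - Ψ₁ s‖) := by ring
        _ ≤ C * C * (‖V₂ t s‖ * ‖V₁ t s - Ψ₁ s‖) := by gcongr; exact hW t s
        _ = _ := by ring
    · rw [norm_mul, norm_mul, Complex.norm_real, norm_mul, Real.norm_of_nonneg (by positivity),
        Real.norm_eq_abs]
      calc (‖V₂ t s‖ + ‖Ψ₂ s‖) * |‖V₂ t s‖ - ‖Ψ₂ s‖| * ‖Ψ₁ s‖ * ‖W t s‖
          = ‖Ψ₁ s‖ * ‖W t s‖ * ((‖V₂ t s‖ + ‖Ψ₂ s‖) * |‖V₂ t s‖ - ‖Ψ₂ s‖|) := by ring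
        _ ≤ C * C * ((‖V₂ t s‖ + ‖Ψ₂ s‖) * ‖V₂ t s - Ψ₂ s‖) := by
          gcongr
          · exact hW t s
          · exact abs_norm_sub_norm_le _ _
        _ = _ := by ring
    · rw [norm_mul, norm_mul, Complex.norm_real, norm_pow, norm_norm]
      calc ‖Ψ₂ s‖ ^ 2 * ‖Ψ₁ s‖ * ‖W t s - θ s‖ ≤ ‖Ψ₂ s‖ ^ 2 * C * ε t := by
            gcongr
            exact hWθ t s
        _ = _ := by ring
  refine hsum.trans ?_
  rw [integral_add j₃ i₄, integral_add j₁ j₂, integral_const_mul,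
    integral_const_mul, integral_const_mul, integral_add i₂ i₃, ← L2_norm_sq_eq]
  gcongr
  · exact integral_norm_mul_norm_le _ _
  · exact integral_norm_mul_norm_le _ _
  · exact integral_norm_mul_norm_le _ _

/-! ### Test waves and the cubic term in profile variables. -/

theorem kernelConst_neg {t : ℝ} (ht : t ≠ 0) :
    kernelConst (-t) = starRingEnd ℂ (kernelConst t) := by
  have harg : (2 * Real.pi * t * Complex.I).arg ≠ Real.pi := by
    rw [Ne, Complex.arg_eq_pi_iff]
    simp [ht, Real.pi_ne_zero]
  have h := Complex.cpow_conj (2 * Real.pi * t * Complex.I) (1 / 2) harg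
  have e₁ : starRingEnd ℂ (1 / 2 : ℂ) = 1 / 2 := by simp [Complex.conj_ofNat]
  have e₂ : starRingEnd ℂ (2 * Real.pi * t * Complex.I) = 2 * Real.pi * (-t : ℝ) * Complex.I := by
    simp [Complex.conj_ofNat]
  rw [e₁, e₂] at h
  rw [kernelConst, kernelConst, map_div₀, map_one, h, Complex.conj_conj]

theorem norm_sq_kernelConst {t : ℝ} (ht : 0 < t) : ‖kernelConst t‖ ^ 2 = (2 * Real.pi * t)⁻¹ := by
  have hp : 0 < 2 * Real.pi * t := by positivity
  have hne : (2 * Real.pi * t * Complex.I : ℂ) ≠ 0 := by simp [ht.ne', Real.pi_ne_zero]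
  have hn : ‖(2 * Real.pi * t * Complex.I : ℂ)‖ = 2 * Real.pi * t := by
    simp [abs_of_pos ht, abs_of_pos Real.pi_pos]
  have h : ‖(2 * Real.pi * t * Complex.I : ℂ) ^ (1 / 2 : ℂ)‖ ^ 2 = 2 * Real.pi * t := by
    rw [← norm_pow, ← Complex.cpow_nat_mul]
    norm_num
    rw [abs_of_pos ht, abs_of_pos Real.pi_pos]
  rw [kernelConst, norm_div, norm_one, div_pow, h, one_pow, one_div]

/-- The free evolution of the test function with transform `θ`. -/
noncomputable def testWave (θ : 𝓢(ℝ, ℂ)) (t : ℝ) : 𝓢(ℝ, ℂ) := 𝓕 (freeSymbolMul (-t) θ)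

/-- The rescaled profile of `testWave θ`. -/
noncomputable def testProfile (θ : 𝓢(ℝ, ℂ)) (t s : ℝ) : ℂ :=
  𝓕 (fun y => chirp (-t) y * 𝓕 θ y) (-s)

/-- This is the factorization at time `-t`. The pairing is bilinear, so reversing time supplies the
conjugate constant and phase needed to cancel those of the solution. The dilation by `-t` accounts
for the reflection in `testProfile`. -/
theorem testWave_eq {t : ℝ} (ht : 0 < t) (θ : 𝓢(ℝ, ℂ)) (x : ℝ) :
    testWave θ t x = kernelConst (-t) * chirp (-t) x * testProfile θ t (x / (2 * Real.pi * t)) := by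
  have h := fourier_freeSymbolMul_fourierInv (neg_ne_zero.2 ht.ne') (𝓕 θ) x
  rw [FourierTransform.fourierInv_fourier_eq, integral_kernel_eq (neg_ne_zero.2 ht.ne')] at h
  rw [testWave, h, testProfile, mul_neg, div_neg]

theorem continuous_testProfile (θ : 𝓢(ℝ, ℂ)) (t : ℝ) : Continuous (testProfile θ t) :=
  (continuous_fourier_of_integrable (integrable_chirp_mul (-t) (𝓕 θ).integrable)).comp
    continuous_neg

theorem norm_testProfile_le (θ : 𝓢(ℝ, ℂ)) (t s : ℝ) : ‖testProfile θ t s‖ ≤ ∫ y, ‖𝓕 θ y‖ := by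
  rw [testProfile, Real.fourier_real_eq_integral_exp_smul]
  refine (norm_integral_le_integral_norm _).trans (le_of_eq ?_)
  refine integral_congr_ae (Eventually.of_forall fun y => ?_)
  simp only
  rw [norm_smul, Complex.norm_exp_ofReal_mul_I, one_mul, norm_mul, norm_chirp, one_mul]

theorem norm_testProfile_sub_le (θ : 𝓢(ℝ, ℂ)) (t s : ℝ) :
    ‖testProfile θ t s - θ s‖ ≤ ∫ y, ‖chirp (-t) y - 1‖ * ‖𝓕 θ y‖ := by
  have h : θ s = 𝓕 ((𝓕 θ : 𝓢(ℝ, ℂ)) : ℝ → ℂ) (-s) := by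
    rw [← Real.fourierInv_eq_fourier_neg, ← SchwartzMap.fourierInv_coe,
      FourierTransform.fourierInv_fourier_eq]
  rw [h, testProfile]
  refine (norm_fourier_sub_le (integrable_chirp_mul (-t) (𝓕 θ).integrable)
    (𝓕 θ).integrable (-s)).trans (le_of_eq ?_)
  refine integral_congr_ae (Eventually.of_forall fun y => ?_)
  simp only
  rw [← norm_mul, sub_mul, one_mul]

theorem tendsto_integral_chirp_sub_one (θ : 𝓢(ℝ, ℂ)) :
    Tendsto (fun t => ∫ y, ‖chirp (-t) y - 1‖ * ‖𝓕 θ y‖) atTop (𝓝 0) := by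
  have h : Tendsto (fun t => ∫ y, ‖chirp (-t) y - 1‖ * ‖𝓕 θ y‖) atTop
      (𝓝 (∫ _ : ℝ, (0 : ℝ))) := by
    refine tendsto_integral_filter_of_dominated_convergence (fun y => 2 * ‖𝓕 θ y‖) ?_ ?_
      ((𝓕 θ).integrable.norm.const_mul 2) ?_
    · refine Eventually.of_forall fun t => ?_
      exact ((measurable_chirp (-t)).sub_const 1).norm.aestronglyMeasurable.mul
        (𝓕 θ).continuous.norm.aestronglyMeasurable
    · refine Eventually.of_forall fun t => Eventually.of_forall fun y => ?_
      rw [norm_mul, norm_norm, norm_norm]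
      exact mul_le_mul_of_nonneg_right (norm_chirp_sub_one_le_two _ _) (norm_nonneg _)
    · refine Eventually.of_forall fun y => ?_
      have h₁ : Tendsto (fun t => chirp (-t) y) atTop (𝓝 1) := by
        simp_rw [chirp_neg]
        simpa using! (Complex.continuous_conj.tendsto 1).comp (tendsto_chirp y)
      simpa using (h₁.sub_const 1).norm.mul_const ‖𝓕 θ y‖
  simpa using h

/-- The four kernel constants combine to `(2πt)⁻²` and the phases cancel in conjugate pairs. The
change of variables `s = x / (2πt)` returns one factor `2πt`, leaving the borderline rate `1/t`. -/
theorem integral_cubic_testWave {t : ℝ} (ht : 0 < t) (u₁ u₂ : ℝ → L2R) (θ : 𝓢(ℝ, ℂ))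
    (h₁ : Integrable (freeU (-t) (u₁ t))) (h₂ : Integrable (freeU (-t) (u₂ t))) :
    ∫ x, cubic (u₂ t) (u₁ t) x * testWave θ t x =
      (2 * Real.pi * t : ℂ)⁻¹ * ∫ s, cubic (profile u₂ t) (profile u₁ t) s * testProfile θ t s := by
  have hp : 0 < 2 * Real.pi * t := by positivity
  have key : ∀ u : ℝ → L2R, Integrable (freeU (-t) (u t)) → ∀ᵐ x, u t x =
      kernelConst t * chirp t x * profile u t (x / (2 * Real.pi * t)) := fun u hu => by
    have e := freeU_ae_eq ht.ne' _ hu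
    rw [freeU_freeU_neg] at e
    filter_upwards [e, ae_comp_div hp.ne' (coeFn_profile u t hu)] with x hx hx'
    rw [hx, hx']
  obtain ⟨g, hg⟩ : ∃ g : ℝ → ℂ, g = fun s => ((2 * Real.pi * t : ℂ)⁻¹) ^ 2 *
    (cubic (profile u₂ t) (profile u₁ t) s * testProfile θ t s) := ⟨_, rfl⟩
  have hint : ∫ x, cubic (u₂ t) (u₁ t) x * testWave θ t x = ∫ x, g (x / (2 * Real.pi * t)) := by
    refine integral_congr_ae ?_
    filter_upwards [key u₁ h₁, key u₂ h₂] with x e₁ e₂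
    simp only [hg, cubic]
    rw [e₁, e₂, testWave_eq ht, kernelConst_neg ht.ne', chirp_neg, norm_mul, norm_mul,
      norm_chirp, mul_one, mul_pow, norm_sq_kernelConst ht]
    have c₁ := Complex.mul_conj (kernelConst t)
    have c₂ := Complex.mul_conj (chirp t x)
    rw [Complex.normSq_eq_norm_sq, norm_sq_kernelConst ht] at c₁
    rw [Complex.normSq_eq_norm_sq, norm_chirp] at c₂
    push_cast at c₁ c₂ ⊢
    set P₁ := profile u₁ t (x / (2 * Real.pi * t))
    set P₂ : ℂ := (‖profile u₂ t (x / (2 * Real.pi * t))‖ : ℂ)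
    set T := testProfile θ t (x / (2 * Real.pi * t))
    set z := (2 * Real.pi * t : ℂ)⁻¹
    calc z * P₂ ^ 2 * (kernelConst t * chirp t x * P₁) *
          (starRingEnd ℂ (kernelConst t) * starRingEnd ℂ (chirp t x) * T)
        = z * P₂ ^ 2 * P₁ * T * (kernelConst t * starRingEnd ℂ (kernelConst t)) *
          (chirp t x * starRingEnd ℂ (chirp t x)) := by ring
      _ = z ^ 2 * (P₂ ^ 2 * P₁ * T) := by rw [c₁, c₂]; ring
  rw [hint, Measure.integral_comp_div, hg, integral_const_mul, abs_of_pos hp, Complex.real_smul]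
  push_cast
  have : (2 * Real.pi * t : ℂ) ≠ 0 := by exact_mod_cast hp.ne'
  field_simp

/-! ### Differentiating the pairing with a moving test wave. -/

/-- A Schwartz function as an element of `L²`. -/
noncomputable def SchwartzMap.toL2 (φ : 𝓢(ℝ, ℂ)) : L2R := φ.toLp 2 volume

theorem SchwartzMap.coeFn_toL2 (φ : 𝓢(ℝ, ℂ)) : φ.toL2 =ᵐ[volume] φ := φ.coeFn_toLp 2 volume

theorem SchwartzMap.toL2_fourier (φ : 𝓢(ℝ, ℂ)) : (𝓕 φ.toL2 : L2R) = (𝓕 φ).toL2 :=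
  SchwartzMap.toLp_fourier_eq φ

/-- The bilinear pairing `∫ f g` on `L²`. -/
noncomputable def pairing : L2R →L[ℂ] L2R →L[ℂ] ℂ :=
  (ContinuousLinearMap.mul ℂ ℂ).lpPairing volume 2 2

theorem pairing_apply (f g : L2R) : pairing f g = ∫ x, f x * g x := by
  rw [pairing, ContinuousLinearMap.lpPairing_eq_integral]
  rfl

theorem norm_pairing_le (f g : L2R) : ‖pairing f g‖ ≤ ‖f‖ * ‖g‖ := by
  rw [pairing_apply]
  refine (norm_integral_le_integral_norm _).trans ?_
  simp_rw [norm_mul]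
  exact integral_norm_mul_norm_le f g

theorem pairing_toL2 (f : L2R) (φ : 𝓢(ℝ, ℂ)) : pairing f (φ.toL2) = ∫ x, f x * φ x := by
  rw [pairing_apply]
  refine integral_congr_ae ?_
  filter_upwards [φ.coeFn_toL2] with x hx
  rw [hx]

/-- Multiplication of a Schwartz function by the symbol `(2πξ)²/2` of `-(1/2)∂ₓ²`. -/
noncomputable def kineticMul (θ : 𝓢(ℝ, ℂ)) : 𝓢(ℝ, ℂ) :=
  SchwartzMap.smulLeftCLM ℂ (fun ξ : ℝ => (((2 * Real.pi) ^ 2 / 2 : ℝ) : ℂ) * (ξ : ℂ) ^ 2) θ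

theorem kineticMul_apply (θ : 𝓢(ℝ, ℂ)) (ξ : ℝ) :
    kineticMul θ ξ = (((2 * Real.pi * ξ) ^ 2 / 2 : ℝ) : ℂ) * θ ξ := by
  have h : (fun ξ : ℝ => (((2 * Real.pi) ^ 2 / 2 : ℝ) : ℂ) * (ξ : ℂ) ^ 2).HasTemperateGrowth :=
    (Function.HasTemperateGrowth.const _).mul (Complex.ofRealCLM.hasTemperateGrowth.pow 2)
  rw [kineticMul, SchwartzMap.smulLeftCLM_apply_apply h, smul_eq_mul]
  push_cast
  ring

/-- Taylor's formula handles `|a| ≤ 1`; for `|a| ≥ 1` the triangle inequality gives `2|a| ≤ 2a²`. A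
global quadratic bound lets the remainder be integrated over all frequencies. -/
theorem norm_exp_ofReal_mul_I_sub_one_sub_le (a : ℝ) :
    ‖Complex.exp (a * Complex.I) - 1 - a * Complex.I‖ ≤ 2 * a ^ 2 := by
  have hn : ‖(a : ℂ) * Complex.I‖ = |a| := by simp
  rcases le_total |a| 1 with h | h
  · have := Complex.norm_exp_sub_one_sub_id_le (hn.trans_le h)
    rw [hn, sq_abs] at this
    nlinarith [sq_nonneg a]
  · have h₁ : ‖Complex.exp (a * Complex.I) - 1‖ ≤ |a| := by
      rw [mul_comm]
      exact Real.norm_exp_I_mul_ofReal_sub_one_le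
    have := norm_sub_le (Complex.exp (a * Complex.I) - 1) (a * Complex.I)
    rw [hn] at this
    nlinarith [sq_abs a]

theorem norm_freeSymbol_sub_le (t τ ξ : ℝ) :
    ‖freeSymbol (-τ) ξ - freeSymbol (-t) ξ - (τ - t : ℝ) *
      (Complex.I * ((2 * Real.pi * ξ) ^ 2 / 2 : ℝ) * freeSymbol (-t) ξ)‖ ≤
      2 * (τ - t) ^ 2 * ((2 * Real.pi * ξ) ^ 2 / 2) ^ 2 := by
  set a : ℝ := (2 * Real.pi * ξ) ^ 2 / 2 with ha
  have h₁ : freeSymbol (-τ) ξ = freeSymbol (-t) ξ * Complex.exp (((τ - t) * a : ℝ) * Complex.I) := by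
    rw [freeSymbol, freeSymbol, ← Complex.exp_add, ← add_mul, ← Complex.ofReal_add]
    congr 3
    rw [ha]
    ring
  have h₂ : freeSymbol (-τ) ξ - freeSymbol (-t) ξ - (τ - t : ℝ) *
      (Complex.I * (a : ℝ) * freeSymbol (-t) ξ) = freeSymbol (-t) ξ *
      (Complex.exp (((τ - t) * a : ℝ) * Complex.I) - 1 - ((τ - t) * a : ℝ) * Complex.I) := by
    rw [h₁]
    push_cast
    ring
  rw [h₂, norm_mul, norm_freeSymbol, one_mul]
  refine (norm_exp_ofReal_mul_I_sub_one_sub_le _).trans (le_of_eq ?_)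
  ring

theorem norm_toL2_fourier (φ : 𝓢(ℝ, ℂ)) : ‖(𝓕 φ).toL2‖ = ‖φ.toL2‖ := by
  rw [← SchwartzMap.toL2_fourier, Lp.norm_fourier_eq]

/-- By Plancherel this is the pointwise Taylor bound for the symbol. The squared frequency weight in
the remainder is absorbed by the decay of `θ`, hence the two applications of `kineticMul`. -/
theorem norm_testWave_sub_le (θ : 𝓢(ℝ, ℂ)) (t τ : ℝ) :
    ‖(testWave θ τ).toL2 - (testWave θ t).toL2 -
      ((τ - t : ℝ) : ℂ) • Complex.I • (testWave (kineticMul θ) t).toL2‖ ≤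
      2 * (τ - t) ^ 2 * ‖(kineticMul (kineticMul θ)).toL2‖ := by
  have hF : (testWave θ τ).toL2 - (testWave θ t).toL2 -
      ((τ - t : ℝ) : ℂ) • Complex.I • (testWave (kineticMul θ) t).toL2 =
      𝓕 ((freeSymbolMul (-τ) θ).toL2 - (freeSymbolMul (-t) θ).toL2 -
        ((τ - t : ℝ) : ℂ) • Complex.I • (freeSymbolMul (-t) (kineticMul θ)).toL2 : L2R) := by
    simp only [sub_eq_add_neg, FourierTransform.fourier_add, FourierTransform.fourier_neg,
      FourierTransform.fourier_smul, SchwartzMap.toL2_fourier, testWave]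
  rw [hF, Lp.norm_fourier_eq]
  refine Lp.norm_le_mul_norm_of_ae_le_mul ?_
  have e₃ := (freeSymbolMul (-t) (kineticMul θ)).coeFn_toL2
  filter_upwards [(freeSymbolMul (-τ) θ).coeFn_toL2, (freeSymbolMul (-t) θ).coeFn_toL2, e₃,
    (kineticMul (kineticMul θ)).coeFn_toL2,
    Lp.coeFn_sub ((freeSymbolMul (-τ) θ).toL2 -
      (freeSymbolMul (-t) θ).toL2)
      (((τ - t : ℝ) : ℂ) • Complex.I • (freeSymbolMul (-t) (kineticMul θ)).toL2),
    Lp.coeFn_sub ((freeSymbolMul (-τ) θ).toL2)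
      ((freeSymbolMul (-t) θ).toL2),
    Lp.coeFn_smul ((τ - t : ℝ) : ℂ)
      (Complex.I • (freeSymbolMul (-t) (kineticMul θ)).toL2),
    Lp.coeFn_smul Complex.I ((freeSymbolMul (-t) (kineticMul θ)).toL2)]
    with ξ e₁ e₂ e₃ e₄ e₅ e₆ e₇ e₈
  rw [e₅, Pi.sub_apply, e₆, Pi.sub_apply, e₇, Pi.smul_apply, e₈, Pi.smul_apply, e₁, e₂, e₃, e₄,
    freeSymbolMul_apply, freeSymbolMul_apply, freeSymbolMul_apply, kineticMul_apply,
    kineticMul_apply, kineticMul_apply, norm_mul, norm_mul, Complex.norm_real,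
    Real.norm_of_nonneg (by positivity : (0 : ℝ) ≤ (2 * Real.pi * ξ) ^ 2 / 2)]
  have h := mul_le_mul_of_nonneg_right (norm_freeSymbol_sub_le t τ ξ) (norm_nonneg (θ ξ))
  rw [← norm_mul] at h
  refine (le_of_eq ?_).trans (h.trans (le_of_eq ?_))
  · congr 1
    simp only [smul_eq_mul]
    ring
  · ring

theorem hasDerivAt_testWave (θ : 𝓢(ℝ, ℂ)) (t : ℝ) :
    HasDerivAt (fun τ => (testWave θ τ).toL2)
      (Complex.I • (testWave (kineticMul θ) t).toL2) t := by
  rw [hasDerivAt_iff_isLittleO]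
  refine Asymptotics.IsBigO.trans_isLittleO ?_
    (Asymptotics.isLittleO_pow_sub_sub t (by norm_num : 1 < 2))
  refine Asymptotics.IsBigO.of_bound
    (2 * ‖(kineticMul (kineticMul θ)).toL2‖)
    (Eventually.of_forall fun τ => ?_)
  rw [RCLike.real_smul_eq_coe_smul (K := ℂ)]
  refine (norm_testWave_sub_le θ t τ).trans (le_of_eq ?_)
  rw [Real.norm_eq_abs, Real.norm_eq_abs, abs_pow, abs_abs, sq_abs]
  ring

theorem iteratedDeriv_two_testWave (θ : 𝓢(ℝ, ℂ)) (t x : ℝ) :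
    iteratedDeriv 2 (testWave θ t) x = -2 * testWave (kineticMul θ) t x := by
  have hint : ∀ n : ℕ, (n : ℕ∞) ≤ (⊤ : ℕ∞) →
      Integrable fun ξ : ℝ => ξ ^ n • freeSymbolMul (-t) θ ξ := fun n _ => by
    have h := (freeSymbolMul (-t) θ).integrable_pow_mul volume n
    refine h.mono (Continuous.aestronglyMeasurable
      (by have := (freeSymbolMul (-t) θ).continuous; fun_prop)) (Eventually.of_forall fun ξ => ?_)
    rw [norm_smul, norm_pow, norm_mul, norm_pow, norm_norm, norm_norm]
  have h := congrFun (Real.iteratedDeriv_fourier (n := 2) hint le_top) x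
  rw [testWave, SchwartzMap.fourier_coe, h, testWave, SchwartzMap.fourier_coe,
    Real.fourier_real_eq_integral_exp_smul, Real.fourier_real_eq_integral_exp_smul,
    ← integral_const_mul]
  refine integral_congr_ae (Eventually.of_forall fun ξ => ?_)
  simp only [freeSymbolMul_apply, kineticMul_apply, smul_eq_mul]
  push_cast
  ring_nf
  rw [Complex.I_sq]
  ring

/-- The kinetic term of the equation cancels against the time derivative of the test wave, leaving
only the nonlinearity. -/
theorem SolvesComponent.hasDerivAt_testWave {T₀ : ℝ} {u v : ℝ → L2R} (h : SolvesComponent T₀ u v)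
    (hu : ContinuousOn u (Set.Ici T₀)) (θ : 𝓢(ℝ, ℂ)) {t : ℝ} (ht : T₀ < t) :
    HasDerivAt (fun τ => ∫ x, u τ x * testWave θ τ x)
      (-∫ x, cubic (v t) (u t) x * testWave θ t x) t := by
  have hcont : ContinuousAt u t := hu.continuousAt (Ici_mem_nhds ht)
  have hQ := (h (testWave θ t) t ht).2
  -- Since `u` is only continuous into `L²`, the product rule is split by hand. Here the second
  -- factor vanishes at `τ = t`, so continuity of `u` and differentiability of the wave suffice; the
  -- rest, with the wave frozen at time `t`, is the weak equation.
  have hP : HasDerivAt (fun τ => pairing (u τ) ((testWave θ τ).toL2 - (testWave θ t).toL2))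
      (pairing (u t) (Complex.I • (testWave (kineticMul θ) t).toL2)) t := by
    rw [hasDerivAt_iff_tendsto_slope]
    have hs := (hasDerivAt_iff_tendsto_slope.1 (_root_.hasDerivAt_testWave θ t))
    have hlim := (pairing.isBoundedBilinearMap.continuous.tendsto
      (u t, Complex.I • (testWave (kineticMul θ) t).toL2)).comp
      ((hcont.tendsto.mono_left nhdsWithin_le_nhds).prodMk_nhds hs)
    refine hlim.congr fun τ => ?_
    simp only [Function.comp, slope, vsub_eq_sub, sub_self, map_zero, sub_zero]
    rw [ContinuousLinearMap.map_smul_of_tower]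
  have := hP.add hQ
  refine (this.congr_deriv ?_).congr_of_eventuallyEq (Eventually.of_forall fun τ => ?_)
  · rw [map_smul, pairing_toL2]
    simp_rw [iteratedDeriv_two_testWave, mul_left_comm _ (-2 : ℂ), integral_const_mul]
    rw [smul_eq_mul]
    ring
  · simp only [Pi.add_apply]
    rw [map_sub, pairing_toL2, pairing_toL2]
    ring

theorem norm_testWave_le (θ : 𝓢(ℝ, ℂ)) (t : ℝ) :
    ‖(testWave θ t).toL2‖ ≤ ‖θ.toL2‖ := by
  rw [testWave, norm_toL2_fourier]
  refine Lp.norm_le_norm_of_ae_le ?_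
  filter_upwards [(freeSymbolMul (-t) θ).coeFn_toL2, θ.coeFn_toL2] with ξ h₁ h₂
  rw [h₁, h₂, freeSymbolMul_apply, norm_mul, norm_freeSymbol, one_mul]

/-! ### Logarithmic divergence and conclusion. -/

/-- A bounded function whose derivative is asymptotic to `c / t` has `c = 0`. -/
theorem eq_zero_of_bounded_of_tendsto_mul_deriv {g g' : ℝ → ℂ} {c : ℂ} {K : ℝ}
    (hg : ∀ᶠ t in atTop, HasDerivAt g (g' t) t) (hb : ∀ᶠ t in atTop, ‖g t‖ ≤ K)
    (hc : Tendsto (fun t : ℝ => (t : ℂ) * g' t) atTop (𝓝 c)) : c = 0 := by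
  by_contra hne
  have hpos : 0 < ‖c‖ ^ 2 := by positivity
  -- Half the limit of `Re(c̄ t g'(t))`, so that `Re(c̄ g') ≥ m/t` eventually.
  set m : ℝ := ‖c‖ ^ 2 / 2 with hm
  have hre : Tendsto (fun t : ℝ => (starRingEnd ℂ c * ((t : ℂ) * g' t)).re) atTop
      (𝓝 (‖c‖ ^ 2)) := by
    have h₁ := (Complex.continuous_re.tendsto _).comp (hc.const_mul (starRingEnd ℂ c))
    have h₂ : (starRingEnd ℂ c * c).re = ‖c‖ ^ 2 := by
      rw [mul_comm, Complex.mul_conj, Complex.ofReal_re, Complex.normSq_eq_norm_sq]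
    rw [h₂] at h₁
    exact h₁
  have hlow : ∀ᶠ t : ℝ in atTop, m ≤ (starRingEnd ℂ c * ((t : ℂ) * g' t)).re :=
    hre.eventually (eventually_ge_nhds (by linarith))
  obtain ⟨T, hT⟩ := eventually_atTop.1 ((hg.and hb).and (hlow.and (eventually_gt_atTop 0)))
  have hder : ∀ t ∈ Set.Ici T, HasDerivAt
      (fun t => (starRingEnd ℂ c * g t).re - m * Real.log t)
      ((starRingEnd ℂ c * g' t).re - m * t⁻¹) t := fun t ht => by
    have ht0 := (hT t ht).2.2
    have h₁ := ((hT t ht).1.1.const_mul (starRingEnd ℂ c))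
    have h₂ : HasDerivAt (fun t => (starRingEnd ℂ c * g t).re) (starRingEnd ℂ c * g' t).re t :=
      Complex.reCLM.hasFDerivAt.comp_hasDerivAt t h₁
    exact h₂.sub ((Real.hasDerivAt_log ht0.ne').const_mul m)
  -- Monotonicity makes `Re(c̄ g)` grow at least like `m log t`, which contradicts the bound `‖c‖ *
  -- K`.
  have hmono : MonotoneOn (fun t => (starRingEnd ℂ c * g t).re - m * Real.log t) (Set.Ici T) := by
    refine monotoneOn_of_deriv_nonneg (convex_Ici T)
      (fun t ht => (hder t ht).continuousAt.continuousWithinAt)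
      (fun t ht => (hder t (interior_subset ht)).differentiableAt.differentiableWithinAt)
      fun t ht => ?_
    have ht' := interior_subset ht
    rw [(hder t ht').deriv]
    obtain ⟨hl, ht0⟩ := (hT t ht').2
    have e : (starRingEnd ℂ c * ((t : ℂ) * g' t)).re = t * (starRingEnd ℂ c * g' t).re := by
      rw [mul_left_comm, Complex.re_ofReal_mul]
    rw [e] at hl
    rw [sub_nonneg, ← div_eq_mul_inv, div_le_iff₀ ht0]
    linarith
  have hlog : Tendsto (fun t => m * Real.log t) atTop atTop :=
    Real.tendsto_log_atTop.const_mul_atTop (by positivity)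
  obtain ⟨t, ht, htT⟩ := ((hlog.eventually_gt_atTop
    (‖c‖ * K - ((starRingEnd ℂ c * g T).re - m * Real.log T))).and (eventually_ge_atTop T)).exists
  have h₁ := hmono Set.self_mem_Ici htT htT
  have h₂ : (starRingEnd ℂ c * g t).re ≤ ‖c‖ * K := by
    refine (Complex.re_le_norm _).trans ?_
    rw [norm_mul, Complex.norm_conj]
    exact mul_le_mul_of_nonneg_left (hT t htT).1.2 (norm_nonneg _)
  simp only at h₁
  linarith

theorem propositionB1 (T₀ : ℝ) (hT₀ : 1 ≤ T₀) (u₁ u₂ : ℝ → L2R)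
    (hu : IsSolution T₀ u₁ u₂)
    (γ : ℝ) (hγ : γ ∈ Set.Ioo (0 : ℝ) (1 / 12))
    (hbd₁ : ProfileBounded T₀ γ u₁) (hbd₂ : ProfileBounded T₀ γ u₂)
    (ψ₁ ψ₂ : L2R)
    (hψ₁ : MemLp (hat ψ₁) ∞ volume) (hψ₂ : MemLp (hat ψ₂) ∞ volume)
    (hsc₁ : ScattersTo u₁ ψ₁) (hsc₂ : ScattersTo u₂ ψ₂) :
    ∀ᵐ ξ : ℝ, hat ψ₁ ξ * hat ψ₂ ξ = 0 := by
  have hγ' : γ ≤ 1 / 8 := by linarith [hγ.2]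
  obtain ⟨C₁, hC₁, hb₁⟩ := hbd₁.exists_bound hT₀ hγ'
  obtain ⟨C₂, hC₂, hb₂⟩ := hbd₂.exists_bound hT₀ hγ'
  have hΨ := norm_fourier_le_of_hat_bounded ψ₁
    (exists_ae_norm_le_of_eLpNorm_top_lt hψ₁.2.ne le_rfl)
  set C₃ := √(2 * Real.pi) * (eLpNorm (hat ψ₁) ∞ volume).toReal
  have hzero : ∀ θ : 𝓢(ℝ, ℂ), ∫ s, cubic (𝓕 ψ₂) (𝓕 ψ₁) s * θ s = 0 := fun θ => by
    set C := max (max C₁ C₂) (max C₃ (∫ y, ‖𝓕 θ y‖)) with hC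
    have hp₁ : ∀ᶠ t in atTop, ∀ᵐ s, ‖profile u₁ t s‖ ≤ C := by
      filter_upwards [eventually_ge_atTop T₀] with t ht
      filter_upwards [coeFn_profile u₁ t (hb₁ t ht).1, (hb₁ t ht).2] with s h₁ h₂
      rw [h₁]
      exact h₂.trans ((le_max_left _ _).trans (le_max_left _ _))
    have hp₂ : ∀ᶠ t in atTop, ∀ᵐ s, ‖profile u₂ t s‖ ≤ C := by
      filter_upwards [eventually_ge_atTop T₀] with t ht
      filter_upwards [coeFn_profile u₂ t (hb₂ t ht).1, (hb₂ t ht).2] with s h₁ h₂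
      rw [h₁]
      exact h₂.trans ((le_max_right _ _).trans (le_max_left _ _))
    have hlim := tendsto_integral_cubic_mul hsc₁.tendsto_profile hsc₂.tendsto_profile hp₁ hp₂
      (hΨ.mono fun s hs => hs.trans ((le_max_left _ _).trans (le_max_right _ _)))
      (continuous_testProfile θ) θ.continuous
      (fun t s => (norm_testProfile_le θ t s).trans
        ((le_max_right _ _).trans (le_max_right _ _)))
      (norm_testProfile_sub_le θ) (tendsto_integral_chirp_sub_one θ)
    have hder : ∀ᶠ t in atTop, HasDerivAt (fun τ => ∫ x, u₁ τ x * testWave θ τ x)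
        (-∫ x, cubic (u₂ t) (u₁ t) x * testWave θ t x) t := by
      filter_upwards [eventually_gt_atTop T₀] with t ht
      exact hu.eqn_fst.hasDerivAt_testWave hu.continuousOn_fst θ ht
    -- Scattering bounds `‖u₁ t‖` for large `t`, and the test wave has constant `L²` size, so
    -- Cauchy–Schwarz applies.
    have hbdd : ∀ᶠ t in atTop, ‖∫ x, u₁ t x * testWave θ t x‖ ≤
        (1 + ‖ψ₁‖) * ‖θ.toL2‖ := by
      have hn : ∀ᶠ t in atTop, ‖freeU (-t) (u₁ t) - ψ₁‖ ≤ 1 := by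
        have hlim₀ : Tendsto (fun t => ‖freeU (-t) (u₁ t) - ψ₁‖) atTop (𝓝 0) := by
          refine Tendsto.congr (fun t => ?_) hsc₁
          rw [← norm_freeU_sub t (freeU (-t) (u₁ t)), freeU_freeU_neg]
        exact hlim₀.eventually (eventually_le_nhds one_pos)
      filter_upwards [hn] with t ht
      rw [← pairing_toL2]
      have hu₁ : ‖u₁ t‖ ≤ 1 + ‖ψ₁‖ := by
        rw [← freeU_freeU_neg t (u₁ t), norm_freeU]
        linarith [norm_le_norm_add_norm_sub' (freeU (-t) (u₁ t)) ψ₁]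
      exact (norm_pairing_le _ _).trans
        (mul_le_mul hu₁ (norm_testWave_le θ t) (norm_nonneg _) (by positivity))
    have hc := eq_zero_of_bounded_of_tendsto_mul_deriv (c := -((2 * Real.pi : ℂ)⁻¹ *
      ∫ s, cubic (𝓕 ψ₂) (𝓕 ψ₁) s * θ s)) hder hbdd (by
      refine Tendsto.congr' ?_ (hlim.const_mul ((2 * Real.pi : ℂ)⁻¹)).neg
      filter_upwards [eventually_ge_atTop T₀] with t ht
      have ht0 : 0 < t := by linarith
      rw [integral_cubic_testWave ht0 _ _ _ (hb₁ t ht).1 (hb₂ t ht).1]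
      have : (t : ℂ) ≠ 0 := by exact_mod_cast ht0.ne'
      have : (Real.pi : ℂ) ≠ 0 := by exact_mod_cast Real.pi_ne_zero
      field_simp)
    simpa [Real.pi_ne_zero] using hc
  have hloc : LocallyIntegrable (cubic (𝓕 ψ₂) (𝓕 ψ₁)) := by
    have e : cubic (𝓕 ψ₂) (𝓕 ψ₁) =
        fun s => (𝓕 ψ₁ : L2R) s * ((‖(𝓕 ψ₂ : L2R) s‖ ^ 2 : ℝ) : ℂ) := by
      ext s
      rw [cubic, mul_comm]
    rw [e]
    exact ((integrable_norm_sq_L2 _).ofReal.bdd_mul (Lp.aestronglyMeasurable _)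
      hΨ).locallyIntegrable
  have hae := ae_eq_of_forall_integral_mul_schwartz_eq hloc (g := fun _ => 0)
    (continuous_const.locallyIntegrable) fun θ => by simpa using hzero θ
  -- The vanishing is known in the frequency variable of `𝓕`; the dilation by `2π` carries it to
  -- that of `hat`.
  filter_upwards [ae_comp_div (by positivity : (2 * Real.pi) ≠ 0) hae] with ξ hξ
  rw [hat, hat]
  simp only [cubic, mul_eq_zero] at hξ
  rcases hξ with h | h
  · have : (𝓕 ψ₂ : L2R) (ξ / (2 * Real.pi)) = 0 := by simpa using h
    rw [this]
    ring
  · rw [h]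
    ring
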